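/- **Setting.** There are $K\ge 1$ arms. A pull of arm $k$ yields a random growth in $\mathbb N$ and a random real reward, with expectations $\bar g_k$ and $\bar r_k$; growths are bounded, $\dot g_\top$ is the maximal growth over all arms, and rewards are integrable. Let $x_\top\in\mathbb N$ be the maximal crowd and $\gamma\in[0,1)$ the discount factor. *Populated MDP (PMDP).* The state is the crowd size $x\in\{0,\dots,x_\top\}$. An action assigns an arm to each of the $x$ subjects; the $x$ pulls are independent, the reward is the sum of the individual rewards, and the next crowd is the minimum of $x_\top$ and the sum of the individual growths. Let $V_p^\sigma(x)$ be the $\gamma$-discounted expected value of a policy $\sigma$ started at $x$, and $V_p^*(x)$ the optimal value. *Reduced On-expectation MDP (ROeMDP) for parameters $(g_k,r_k)_k$.* The state is $y\in[0,x_\top]$, an action is a growth $u\in[\min_k g_k,\max_k g_k]$, the next state is $\min\{yu,x_\top\}$ and the reward is $y\,\mathcal R(u)$, where $\mathcal R(u)$ is the maximum of $\sum_k a_k r_k$ over the probability vectors $a$ with $\sum_k a_k g_k=u$; $\Psi(u)$ is the set of maximizers. Let $V_r^{\#}$ be the optimal $\gamma$-discounted value for the true parameters $(\bar g_k,\bar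 r_k)$, and $V^{\#}_\top=\max_{y\in[0,x_\top]}|V_r^{\#}(y)|$ (this is $\max_y V_r^{\#}(y)$ when some $\bar r_k$ is positive). *Estimated policy.* Let $\hat g_k\ge 0$ and $\hat r_k$ be estimates of $\bar g_k$ and $\bar r_k$, let $\hat\pi$ be an optimal policy of the ROeMDP for $(\hat g_k,\hat r_k)$, and let $\hat\psi(y)\in\widehat\Psi(\hat\pi(y))$ for every $y\in[0,x_\top]$. In the PMDP, $\hat\psi$ draws the arm of each subject independently from the distribution $\hat\psi(x)$, where $x$ is the crowd size. Let $\psi^*$ be an optimal policy of the PMDP, and let $\epsilon=\max_k\max(|\bar g_k-\hat g_k|,|\bar r_k-\hat r_k|)$, where $k$ ranges over the arms that are played, with positive probability and in some nonempty state, by $\psi^*$ or by $\hat\psi$. **Theorem.** Assume $\max_k\bar r_k\ne 0$. There is a constant $C>0$, depending only on $\gamma$ and $(\bar g_k,\bar r_k)_k$, such that for all laws of the arms with these expectations, all $x_\top$, all current crowds $2\le x\le x_\top$, all estimates $\hat g_k,\hat r_k$, and all $\hat\pi,\hat\psi,\psi^*$ as above, $$\bigl|V_p^*(x)-V_p^{\hat\psi}(x)\bigr|\;\le\;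 C\left(\frac{\dot g_\top V^{\#}_\top}{1-\gamma}\sqrt{\frac{\ln x}{x}}+\frac{\epsilon\,V^{\#}_\top}{1-\gamma}\right).$$ -/

import Mathlib

open MeasureTheory

noncomputable section

/-- A bandit with `K` arms and crowd externalities. A pull of arm `k` has a random outcome
`(growth, reward)` in `ℕ × ℝ`, with law `law k`; growths are bounded and rewards are integrable.
The growth and the reward of one pull may be dependent. -/
structure CrowdBandit (K : ℕ) where
  law : Fin K → Measure (ℕ × ℝ)
  prob : ∀ k, IsProbabilityMeasure (law k)
  integrable_reward : ∀ k, Integrable (fun o : ℕ × ℝ => o.2) (law k)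
  bounded_growth : ∃ m : ℕ, ∀ k, ∀ᵐ o ∂(law k), o.1 ≤ m

namespace CrowdBandit

variable {K : ℕ}

/-- Expected growth of arm `k`. -/
def meanGrowth (B : CrowdBandit K) (k : Fin K) : ℝ := ∫ o, (o.1 : ℝ) ∂(B.law k)

/-- Expected reward of arm `k`. -/
def meanReward (B : CrowdBandit K) (k : Fin K) : ℝ := ∫ o, o.2 ∂(B.law k)

/-- The maximal growth: the least almost sure bound on the growth of every arm. -/
def maxGrowth (B : CrowdBandit K) : ℕ := sInf {m : ℕ | ∀ k, ∀ᵐ o ∂(B.law k), o.1 ≤ m}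

/-! ### The Populated MDP with maximal crowd `N`

States are the crowd sizes `0, …, N` (`0` is the empty, absorbing crowd); an action
`a : Fin N → Fin K` names the arm that each potential subject receives, and in the state `x` the
first `x` entries are used. -/

/-- The arm given to the `i`-th subject of a crowd of size `x`. -/
def armOf {N : ℕ} (x : Fin (N + 1)) (a : Fin N → Fin K) (i : Fin (x : ℕ)) : Fin K :=
  a (Fin.castLE (Nat.lt_succ_iff.mp x.2) i)

/-- Joint law of the outcomes of one time step: the `x` interactions are independent. -/
def batchLaw (B : CrowdBandit K) {N : ℕ} (x : Fin (N + 1)) (a : Fin N → Fin K) :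
    Measure (Fin (x : ℕ) → ℕ × ℝ) :=
  Measure.pi fun i => B.law (armOf x a i)

/-- The next crowd: the total growth, capped at `N`. -/
def nextCrowd (N : ℕ) {n : ℕ} (o : Fin n → ℕ × ℝ) : Fin (N + 1) :=
  ⟨min (∑ i, (o i).1) N, Nat.lt_succ_iff.mpr (min_le_right _ _)⟩

/-- Expectation of the total reward of one time step. -/
def stepReward (B : CrowdBandit K) {N : ℕ} (x : Fin (N + 1)) (a : Fin N → Fin K) : ℝ :=
  ∫ o, ∑ i, (o i).2 ∂(B.batchLaw x a)

/-- Expectation of `f` at the next crowd. -/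
def stepExpect (B : CrowdBandit K) {N : ℕ} (f : Fin (N + 1) → ℝ) (x : Fin (N + 1))
    (a : Fin N → Fin K) : ℝ :=
  ∫ o, f (nextCrowd N o) ∂(B.batchLaw x a)

/-- A (randomized, stationary) policy of the Populated MDP: `σ x a` is the probability of the
action `a` in the state `x`. -/
def IsPolicy {N : ℕ} (σ : Fin (N + 1) → (Fin N → Fin K) → ℝ) : Prop :=
  ∀ x, σ x ∈ stdSimplex ℝ (Fin N → Fin K)

/-- `expReward B σ t x` is the expected total reward of time step `t` under `σ`, from the initial
crowd `x`. -/
def expReward (B : CrowdBandit K) {N : ℕ} (σ : Fin (N + 1) → (Fin N → Fin K) → ℝ) :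
    ℕ → Fin (N + 1) → ℝ
  | 0, x => ∑ a, σ x a * B.stepReward x a
  | t + 1, x => ∑ a, σ x a * B.stepExpect (expReward B σ t) x a

/-- The `γ`-discounted value of the policy `σ` in the Populated MDP. -/
def value (B : CrowdBandit K) (γ : ℝ) {N : ℕ} (σ : Fin (N + 1) → (Fin N → Fin K) → ℝ)
    (x : Fin (N + 1)) : ℝ :=
  ∑' t : ℕ, γ ^ t * B.expReward σ t x

/-- The optimal value of the Populated MDP. -/
def optValue (B : CrowdBandit K) (γ : ℝ) {N : ℕ} (x : Fin (N + 1)) : ℝ :=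
  sSup {v | ∃ σ : Fin (N + 1) → (Fin N → Fin K) → ℝ, IsPolicy σ ∧ v = B.value γ σ x}

/-- `σ` is an optimal policy of the Populated MDP. -/
def IsOptimal (B : CrowdBandit K) (γ : ℝ) {N : ℕ}
    (σ : Fin (N + 1) → (Fin N → Fin K) → ℝ) : Prop :=
  IsPolicy σ ∧ ∀ x, B.value γ σ x = B.optValue γ x

/-- The policy of the Populated MDP that, with a crowd of size `x`, draws the arm of every subject
independently from the distribution `ψ x` over the arms. -/
def mixedPolicy (N : ℕ) (ψ : ℝ → Fin K → ℝ) : Fin (N + 1) → (Fin N → Fin K) → ℝ :=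
  fun x a => ∏ i, ψ (x : ℕ) (a i)

/-- The arm `k` is played, with positive probability and for some crowd, by the policy `σ` of the
Populated MDP. -/
def Plays {N : ℕ} (σ : Fin (N + 1) → (Fin N → Fin K) → ℝ) (k : Fin K) : Prop :=
  ∃ x a, 0 < σ x a ∧ ∃ i, armOf x a i = k

/-- The arm `k` is played, with positive probability and for some nonempty crowd in the continuous
state space `[0, N]`, by the policy `ψ`. -/
def PlaysMixed (N : ℕ) (ψ : ℝ → Fin K → ℝ) (k : Fin K) : Prop :=
  ∃ y ∈ Set.Ioc (0 : ℝ) N, 0 < ψ y k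

/-- The maximal error of the estimated expected growths `g'` and expected rewards `r'` over the
arms that are played by `σ` or by `ψ`. -/
def modelError (B : CrowdBandit K) {N : ℕ} (g' r' : Fin K → ℝ)
    (σ : Fin (N + 1) → (Fin N → Fin K) → ℝ) (ψ : ℝ → Fin K → ℝ) : ℝ :=
  sSup {e | ∃ k, (Plays σ k ∨ PlaysMixed N ψ k) ∧
    e = max |B.meanGrowth k - g' k| |B.meanReward k - r' k|}

end CrowdBandit

/-! ### The Reduced On-expectation MDP

It is determined by expected growths `g`, expected rewards `r`, the discount factor `γ` and the
maximal crowd `N`. Its states are the real numbers in `[0, N]`. -/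

namespace ROeMDP

variable {K : ℕ}

/-- The transformed reward: the largest expected reward of a distribution over the arms with
expected growth `u`. -/
def reward (g r : Fin K → ℝ) (u : ℝ) : ℝ :=
  sSup {v | ∃ a ∈ stdSimplex ℝ (Fin K), ∑ k, a k * g k = u ∧ v = ∑ k, a k * r k}

/-- The transformed action set: the distributions over the arms that have the largest expected
reward among those with expected growth `u`. -/
def actions (g r : Fin K → ℝ) (u : ℝ) : Set (Fin K → ℝ) :=
  {a | a ∈ stdSimplex ℝ (Fin K) ∧ ∑ k, a k * g k = u ∧
    ∀ b ∈ stdSimplex ℝ (Fin K), ∑ k, b k * g k = u → ∑ k, b k * r k ≤ ∑ k, a k * r k}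

/-- A policy: in every state, a growth between the least and the largest expected growth. -/
def IsPolicy (g : Fin K → ℝ) (N : ℕ) (π : ℝ → ℝ) : Prop :=
  ∀ y ∈ Set.Icc (0 : ℝ) N, π y ∈ Set.Icc (⨅ k, g k) (⨆ k, g k)

/-- The deterministic trajectory of the crowd under the policy `π`. -/
def path (N : ℕ) (π : ℝ → ℝ) (x : ℝ) : ℕ → ℝ
  | 0 => x
  | t + 1 => min (path N π x t * π (path N π x t)) N

/-- The discounted value of the policy `π`. -/
def value (g r : Fin K → ℝ) (γ : ℝ) (N : ℕ) (π : ℝ → ℝ) (x : ℝ) : ℝ :=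
  ∑' t : ℕ, γ ^ t * (path N π x t * reward g r (π (path N π x t)))

/-- The optimal value. -/
def optValue (g r : Fin K → ℝ) (γ : ℝ) (N : ℕ) (x : ℝ) : ℝ :=
  sSup {v | ∃ π : ℝ → ℝ, IsPolicy g N π ∧ v = value g r γ N π x}

/-- `π` is an optimal policy. -/
def IsOptimal (g r : Fin K → ℝ) (γ : ℝ) (N : ℕ) (π : ℝ → ℝ) : Prop :=
  IsPolicy g N π ∧ ∀ x ∈ Set.Icc (0 : ℝ) N, value g r γ N π x = optValue g r γ N x

/-- The maximal (in magnitude) optimal value over the states. It is the maximum of the optimal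
value itself as soon as some expected reward is positive. -/
def maxValue (g r : Fin K → ℝ) (γ : ℝ) (N : ℕ) : ℝ :=
  sSup ((fun x => |optValue g r γ N x|) '' Set.Icc (0 : ℝ) N)

end ROeMDP

end

/-!
The two processes are compared through one function on `[0, N]`, the value `V` of the optimal
policy of the estimated reduced MDP (`ROeMDP.isReducedValue_of_isOptimal`). It solves the Bellman
equation of the estimated model restricted to the set `S` of the arms that are played by `σ` or by
`ψ`, and it is proved that, in the Populated MDP, `V + Φ` is superharmonic for all actions with
arms in `S` while `V - Φ'` is subharmonic under the policy derived from `ψ`. Here `Φ` and `Φ'` are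
corrections of the order `N * (maxGrowth / √x + ε)`. Hence the optimal value is at most `V + Φ`,
and the value of the policy derived from `ψ` is at least `V - Φ'`. This needs `ε` to be small;
otherwise the bound is trivial, as all values are `O(N)`. The bound of the theorem follows, since
the maximal reduced value is at least `N` times `|max r|` (`ROeMDP.mul_abs_le_maxValue`), because
`√(log x)` is bounded below for `x ≥ 2`, and because there are finitely many sets `S`.

All properties of `V` (bounds, monotonicity, concavity, slopes) are derived from the Bellman
equation by one principle, `nonpos_of_le_discounted`: a bounded violation of the property is at
most `γ` times another violation. In one step, the total growth of the crowd deviates from its mean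
by at most `maxGrowth * √(2 * x)` in mean square, so the error depends on how steep `V` is. For the
true parameters of the arms in `S`, there are three cases.

* Linear functions satisfy the Bellman inequalities. Then `V` is Lipschitz uniformly in `N`, up to
  an error `O(N * ε)`, and the fluctuation of a step contributes an error of at most the order of
  `maxGrowth * √N ≤ maxGrowth * N / √x` (`exists_comparison_of_slopes`).
* All rewards are negative, and all growths are at least `1 / γ`. Then the slope of `V` at `y` is
  at most of the order `N / y`, which is large, but the crowd grows under every policy
  (`exists_comparison_of_negative`).
* Some reward is positive and no linear function is a supersolution. Then `V` is concave, so that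
  fluctuations only decrease the expected value, which is the upper bound. For the lower bound, the
  slope of `V` exceeds any given constant below some fraction `δ * N` of the maximal crowd, and
  therefore optimal actions make a crowd below `δ * N` grow
  (`IsReducedValue.min_le_growth_of_attained`, `exists_comparison_of_improvable`).

In the last two cases the errors of the order `maxGrowth * N / √y` at the crowd `y` are summed
along the random trajectory by the potential `crowdPotential`, which contracts by Chebyshev's
inequality (`exists_crowdPotential_contraction`).
-/

open scoped Matrix
open Set

/-! ### Solutions of the Bellman equation of the reduced MDP -/

/-- A discounted recursive bound forces nonpositivity: if `q` is bounded above on `s` and every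
value of `q` is at most `γ` times another value, then `q ≤ 0` on `s`. Properties of solutions of
Bellman equations are obtained from it by letting `q` measure the violation of the property. -/
theorem nonpos_of_le_discounted {X : Type*} {γ : ℝ} (hγ0 : 0 ≤ γ) (hγ1 : γ < 1) {s : Set X}
    {q : X → ℝ} (hb : ∃ b, ∀ x ∈ s, q x ≤ b) (h : ∀ x ∈ s, ∃ y ∈ s, q x ≤ γ * q y) :
    ∀ x ∈ s, q x ≤ 0 := by
  obtain ⟨b, hb⟩ := hb
  have key : ∀ n : ℕ, ∀ x ∈ s, q x ≤ γ ^ n * b := by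
    intro n
    induction n with
    | zero => simpa using hb
    | succ n ih =>
      intro x hx
      obtain ⟨y, hy, hxy⟩ := h x hx
      calc q x ≤ γ * q y := hxy
        _ ≤ γ * (γ ^ n * b) := mul_le_mul_of_nonneg_left (ih y hy) hγ0
        _ = γ ^ (n + 1) * b := by ring
  intro x hx
  have hlim : Filter.Tendsto (fun n : ℕ => γ ^ n * b) Filter.atTop (nhds (0 * b)) :=
    (tendsto_pow_atTop_nhds_zero_of_lt_one hγ0 hγ1).mul_const b
  rw [zero_mul] at hlim
  exact ge_of_tendsto' hlim fun n => key n x hx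

/-- The allocations of a mass `y` to the arms in `S`. They encode the actions of a reduced MDP in
the state `y`, the allocation `m` being `y` times a distribution over the arms; in this form reward
and growth are linear. -/
def allocations {ι : Type*} [Fintype ι] (S : Finset ι) (y : ℝ) : Set (ι → ℝ) :=
  {m | (∀ k, 0 ≤ m k) ∧ (∀ k, k ∉ S → m k = 0) ∧ ∑ k, m k = y}

section Allocations

variable {ι : Type*} [Fintype ι] {S : Finset ι} {y z : ℝ} {m m' : ι → ℝ}

theorem smul_mem_allocations {c : ℝ} (hc : 0 ≤ c) (hm : m ∈ allocations S y) :
    c • m ∈ allocations S (c * y) := by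
  obtain ⟨h1, h2, h3⟩ := hm
  refine ⟨fun k => mul_nonneg hc (h1 k), fun k hk => by simp [h2 k hk], ?_⟩
  simp [← h3, Finset.mul_sum]

theorem add_mem_allocations (hm : m ∈ allocations S y) (hm' : m' ∈ allocations S z) :
    m + m' ∈ allocations S (y + z) := by
  obtain ⟨h1, h2, h3⟩ := hm
  obtain ⟨h1', h2', h3'⟩ := hm'
  refine ⟨fun k => add_nonneg (h1 k) (h1' k), fun k hk => by simp [h2 k hk, h2' k hk], ?_⟩
  simp [← h3, ← h3', Finset.sum_add_distrib]

theorem single_mem_allocations [DecidableEq ι] {k : ι} (hk : k ∈ S) (hy : 0 ≤ y) :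
    Pi.single k y ∈ allocations S y := by
  refine ⟨fun j => ?_, fun j hj => ?_, by simp⟩
  · by_cases h : j = k
    · subst h; simpa using hy
    · simp [h]
  · have : j ≠ k := fun h => hj (h ▸ hk)
    simp [this]

theorem zero_mem_allocations : (0 : ι → ℝ) ∈ allocations S 0 :=
  ⟨fun _ => le_rfl, fun _ _ => rfl, by simp⟩

theorem eq_zero_of_mem_allocations_zero (hm : m ∈ allocations S 0) : m = 0 := by
  funext k
  have := (Finset.sum_eq_zero_iff_of_nonneg fun k _ => hm.1 k).1 hm.2.2 k (Finset.mem_univ k)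
  simpa using this

theorem dotProduct_le_of_mem_allocations (hm : m ∈ allocations S y) {f : ι → ℝ} {b : ℝ}
    (hf : ∀ k ∈ S, f k ≤ b) : m ⬝ᵥ f ≤ b * y := by
  rw [← hm.2.2, dotProduct, Finset.mul_sum]
  refine Finset.sum_le_sum fun k _ => ?_
  by_cases hk : k ∈ S
  · rw [mul_comm b]
    exact mul_le_mul_of_nonneg_left (hf k hk) (hm.1 k)
  · simp [hm.2.1 k hk]

theorem le_dotProduct_of_mem_allocations (hm : m ∈ allocations S y) {f : ι → ℝ} {b : ℝ}
    (hf : ∀ k ∈ S, b ≤ f k) : b * y ≤ m ⬝ᵥ f := by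
  have := dotProduct_le_of_mem_allocations hm (f := -f) (b := -b)
    fun k hk => neg_le_neg (hf k hk)
  rw [dotProduct_neg] at this
  linarith

theorem abs_dotProduct_le_of_mem_allocations (hm : m ∈ allocations S y) {f : ι → ℝ} {b : ℝ}
    (hf : ∀ k ∈ S, |f k| ≤ b) : |m ⬝ᵥ f| ≤ b * y := by
  refine abs_le.2 ⟨?_, dotProduct_le_of_mem_allocations hm fun k hk => (abs_le.1 (hf k hk)).2⟩
  have := le_dotProduct_of_mem_allocations hm (f := f) (b := -b)
    fun k hk => (abs_le.1 (hf k hk)).1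
  linarith

theorem abs_dotProduct_sub_le_of_mem_allocations (hm : m ∈ allocations S y) {f f' : ι → ℝ} {b : ℝ}
    (hf : ∀ k ∈ S, |f k - f' k| ≤ b) : |m ⬝ᵥ f - m ⬝ᵥ f'| ≤ b * y := by
  rw [← dotProduct_sub]
  exact abs_dotProduct_le_of_mem_allocations hm hf

end Allocations

/-- `V` is a bounded solution on `[0, N]` of the Bellman optimality equation of the reduced
on-expectation MDP whose arms are those in `S`, with expected growths `g`, expected rewards `r`,
discount factor `γ` and maximal crowd `N`. -/
structure IsReducedValue {ι : Type*} [Fintype ι] (S : Finset ι) (g r : ι → ℝ) (γ N : ℝ)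
    (V : ℝ → ℝ) : Prop where
  bounded : ∃ b, ∀ y ∈ Icc 0 N, |V y| ≤ b
  ge : ∀ y ∈ Icc 0 N, ∀ m ∈ allocations S y, m ⬝ᵥ r + γ * V (min (m ⬝ᵥ g) N) ≤ V y
  attained : ∀ y ∈ Icc 0 N, ∃ m ∈ allocations S y, V y = m ⬝ᵥ r + γ * V (min (m ⬝ᵥ g) N)

namespace IsReducedValue

variable {ι : Type*} [Fintype ι] {S : Finset ι} {g r : ι → ℝ} {γ N : ℝ} {V : ℝ → ℝ}

theorem next_mem (hN : 0 ≤ N) (hg : ∀ k ∈ S, 0 ≤ g k) {y : ℝ} {m : ι → ℝ}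
    (hm : m ∈ allocations S y) : 0 ≤ m ⬝ᵥ g ∧ min (m ⬝ᵥ g) N ∈ Icc 0 N := by
  have h : 0 ≤ m ⬝ᵥ g := by simpa using le_dotProduct_of_mem_allocations hm hg
  exact ⟨h, le_min h hN, min_le_right _ _⟩

theorem zero (hV : IsReducedValue S g r γ N V) (hγ1 : γ < 1) (hN : 0 ≤ N) : V 0 = 0 := by
  obtain ⟨m, hm, hmV⟩ := hV.attained 0 ⟨le_rfl, hN⟩
  rw [eq_zero_of_mem_allocations_zero hm, zero_dotProduct, zero_dotProduct, min_eq_left hN] at hmV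
  have : (1 - γ) * V 0 = 0 := by linarith
  rcases mul_eq_zero.1 this with h | h
  · linarith
  · exact h

variable (hV : IsReducedValue S g r γ N V) (hγ0 : 0 ≤ γ) (hγ1 : γ < 1) (hN : 0 ≤ N)
  (hg : ∀ k ∈ S, 0 ≤ g k)
include hV hγ0 hγ1 hN hg

theorem abs_le {R : ℝ} (hR0 : 0 ≤ R) (hR : ∀ k ∈ S, |r k| ≤ R) :
    ∀ y ∈ Icc 0 N, |V y| ≤ R * N / (1 - γ) := by
  have hγ : 0 < 1 - γ := by linarith
  have key : ∀ y ∈ Icc 0 N, |V y| - R * N / (1 - γ) ≤ 0 := by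
    refine nonpos_of_le_discounted hγ0 hγ1 ?_ ?_
    · obtain ⟨b, hb⟩ := hV.bounded
      exact ⟨b - R * N / (1 - γ), fun y hy => by linarith [hb y hy]⟩
    · intro y hy
      obtain ⟨m, hm, hmV⟩ := hV.attained y hy
      refine ⟨min (m ⬝ᵥ g) N, (next_mem hN hg hm).2, ?_⟩
      have h1 := abs_dotProduct_le_of_mem_allocations hm hR
      have h2 : R * y ≤ R * N := mul_le_mul_of_nonneg_left hy.2 hR0
      have h3 : |V y| ≤ |m ⬝ᵥ r| + γ * |V (min (m ⬝ᵥ g) N)| := by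
        rw [hmV]
        refine (abs_add_le _ _).trans ?_
        rw [abs_mul, abs_of_nonneg hγ0]
      have h4 : R * N / (1 - γ) * (1 - γ) = R * N := div_mul_cancel₀ _ hγ.ne'
      nlinarith
  exact fun y hy => by linarith [key y hy]

/-- The slopes of `V` are at most `β`, up to an additive error, if the linear function of slope `β`
satisfies the Bellman inequality up to a slope error `η`. -/
theorem sub_le {β η : ℝ} (hβ : 0 ≤ β) (hη : 0 ≤ η)
    (h : ∀ k ∈ S, r k + γ * g k * β ≤ β + η) {y z : ℝ} (hy : 0 ≤ y) (hyz : y ≤ z) (hz : z ≤ N) :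
    V z - V y ≤ β * (z - y) + η * N / (1 - γ) := by
  have hγ : 0 < 1 - γ := by linarith
  set κ := η * N / (1 - γ) with hκ
  have hκ1 : κ * (1 - γ) = η * N := div_mul_cancel₀ _ hγ.ne'
  have hκ0 : 0 ≤ κ := by positivity
  have key : ∀ x ∈ {x : ℝ × ℝ | 0 ≤ x.1 ∧ x.1 ≤ x.2 ∧ x.2 ≤ N},
      V x.2 - V x.1 - β * (x.2 - x.1) - κ ≤ 0 := by
    refine nonpos_of_le_discounted hγ0 hγ1 ?_ ?_
    · obtain ⟨b, hb⟩ := hV.bounded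
      refine ⟨b + b, ?_⟩
      rintro ⟨y, z⟩ ⟨h0, h1, h2⟩
      have h3 := _root_.abs_le.1 (hb y ⟨h0, h1.trans h2⟩)
      have h4 := _root_.abs_le.1 (hb z ⟨h0.trans h1, h2⟩)
      have : 0 ≤ β * (z - y) := mul_nonneg hβ (by simpa using h1)
      simp only; linarith
    · rintro ⟨y, z⟩ ⟨h0, h1, h2⟩
      simp only at h0 h1 h2
      rcases (h0.trans h1).eq_or_lt with hz0 | hz0
      · refine ⟨(0, 0), ⟨le_rfl, le_rfl, hN⟩, ?_⟩
        have : y = 0 := le_antisymm (by rw [hz0]; exact h1) h0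
        subst hz0 this
        simp only; nlinarith
      · obtain ⟨m, hm, hmV⟩ := hV.attained z ⟨hz0.le, h2⟩
        set t := y / z with ht
        have ht0 : 0 ≤ t := div_nonneg h0 hz0.le
        have ht1 : t ≤ 1 := (div_le_one hz0).2 h1
        have htz : t * z = y := div_mul_cancel₀ _ hz0.ne'
        have hm' := smul_mem_allocations ht0 hm
        rw [htz] at hm'
        have hge := hV.ge y ⟨h0, h1.trans h2⟩ _ hm'
        rw [smul_dotProduct, smul_dotProduct, smul_eq_mul, smul_eq_mul] at hge
        obtain ⟨hw, hwm⟩ := next_mem hN hg hm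
        set w := m ⬝ᵥ g with hw_def
        have hwle : t * w ≤ w := mul_le_of_le_one_left hw ht1
        refine ⟨(min (t * w) N, min w N), ⟨le_min (mul_nonneg ht0 hw) hN,
          min_le_min_right _ hwle, min_le_right _ _⟩, ?_⟩
        simp only
        -- the cap does not increase distances
        have hd : min w N - min (t * w) N ≤ (1 - t) * w := by
          rcases le_total (t * w) N with h | h
          · rw [min_eq_left h]; linarith [min_le_left w N]
          · rw [min_eq_right h]; nlinarith [min_le_right w N]
        have hr1 := dotProduct_le_of_mem_allocations hm (f := r + (γ * β) • g) (b := β + η)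
          fun k hk => by
            have := h k hk
            simp only [Pi.add_apply, Pi.smul_apply, smul_eq_mul]; linarith
        rw [dotProduct_add, dotProduct_smul, smul_eq_mul, ← hw_def] at hr1
        have h5 : (1 - t) * (m ⬝ᵥ r + γ * β * w) ≤ (1 - t) * ((β + η) * z) :=
          mul_le_mul_of_nonneg_left hr1 (by linarith)
        have h6 : γ * β * (min w N - min (t * w) N) ≤ γ * β * ((1 - t) * w) :=
          mul_le_mul_of_nonneg_left hd (mul_nonneg hγ0 hβ)
        have h7 : (1 - t) * (η * z) ≤ 1 * (η * N) :=
          mul_le_mul (by linarith) (mul_le_mul_of_nonneg_left h2 hη)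
            (mul_nonneg hη hz0.le) zero_le_one
        rw [hmV]
        have h8 : (1 - t) * z = z - y := by rw [sub_mul, htz, one_mul]
        have h9 : (1 - t) * ((β + η) * z) = β * (z - y) + (1 - t) * (η * z) := by
          rw [← h8]; ring
        nlinarith
  have := key (y, z) ⟨hy, hyz, hz⟩
  simp only at this; linarith

/-- The slopes of `V` are at least `α`, up to an additive error, if the linear function of slope
`α` satisfies the reverse Bellman inequality for one arm, up to a slope error `η`: the additional
mass can be given to that arm. -/
theorem le_sub {α η : ℝ} (hα : α ≤ 0) (hη : 0 ≤ η) {k : ι} (hk : k ∈ S)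
    (h : α - η ≤ r k + γ * g k * α) {y z : ℝ} (hy : 0 ≤ y) (hyz : y ≤ z) (hz : z ≤ N) :
    α * (z - y) - η * N / (1 - γ) ≤ V z - V y := by
  classical
  have hγ : 0 < 1 - γ := by linarith
  set κ := η * N / (1 - γ) with hκ
  have hκ1 : κ * (1 - γ) = η * N := div_mul_cancel₀ _ hγ.ne'
  have key : ∀ x ∈ {x : ℝ × ℝ | 0 ≤ x.1 ∧ x.1 ≤ x.2 ∧ x.2 ≤ N},
      α * (x.2 - x.1) - κ - (V x.2 - V x.1) ≤ 0 := by
    refine nonpos_of_le_discounted hγ0 hγ1 ?_ ?_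
    · obtain ⟨b, hb⟩ := hV.bounded
      have hκ0 : 0 ≤ κ := by positivity
      refine ⟨b + b, ?_⟩
      rintro ⟨y, z⟩ ⟨h0, h1, h2⟩
      have h3 := _root_.abs_le.1 (hb y ⟨h0, h1.trans h2⟩)
      have h4 := _root_.abs_le.1 (hb z ⟨h0.trans h1, h2⟩)
      have : α * (z - y) ≤ 0 := mul_nonpos_of_nonpos_of_nonneg hα (by simpa using h1)
      simp only; linarith
    · rintro ⟨y, z⟩ ⟨h0, h1, h2⟩
      simp only at h0 h1 h2
      obtain ⟨m, hm, hmV⟩ := hV.attained y ⟨h0, h1.trans h2⟩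
      have hzy : 0 ≤ z - y := by linarith
      have hm' := add_mem_allocations hm (single_mem_allocations hk hzy)
      rw [add_sub_cancel] at hm'
      have hge := hV.ge z ⟨h0.trans h1, h2⟩ _ hm'
      rw [add_dotProduct, add_dotProduct, single_dotProduct, single_dotProduct] at hge
      obtain ⟨hw, hwm⟩ := next_mem hN hg hm
      set w := m ⬝ᵥ g with hw_def
      have hgk := hg k hk
      have hwle : w ≤ w + (z - y) * g k := le_add_of_nonneg_right (mul_nonneg hzy hgk)
      refine ⟨(min w N, min (w + (z - y) * g k) N), ⟨hwm.1, min_le_min_right _ hwle,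
        min_le_right _ _⟩, ?_⟩
      simp only
      have hd : min (w + (z - y) * g k) N - min w N ≤ (z - y) * g k := by
        rcases le_total w N with h | h
        · rw [min_eq_left h]; linarith [min_le_left (w + (z - y) * g k) N]
        · rw [min_eq_right h]
          linarith [min_le_right (w + (z - y) * g k) N, mul_nonneg hzy hgk]
      have h6 : γ * -α * (min (w + (z - y) * g k) N - min w N) ≤ γ * -α * ((z - y) * g k) :=
        mul_le_mul_of_nonneg_left hd (mul_nonneg hγ0 (by linarith))
      have h5 : (z - y) * (α - η) ≤ (z - y) * (r k + γ * g k * α) :=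
        mul_le_mul_of_nonneg_left h hzy
      have h7 : η * (z - y) ≤ η * N := mul_le_mul_of_nonneg_left (by linarith) hη
      rw [hmV]
      nlinarith
  have := key (y, z) ⟨hy, hyz, hz⟩
  simp only at this; linarith

theorem monotoneOn {k : ι} (hk : k ∈ S) (hr : 0 ≤ r k) : MonotoneOn V (Icc 0 N) := by
  intro y hy z hz hyz
  have := hV.le_sub hγ0 hγ1 hN hg le_rfl le_rfl hk (by simpa using hr) hy.1 hyz hz.2
  simp at this; linarith

theorem antitoneOn (hr : ∀ k ∈ S, r k ≤ 0) : AntitoneOn V (Icc 0 N) := by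
  intro y hy z hz hyz
  have := hV.sub_le hγ0 hγ1 hN hg le_rfl le_rfl (by simpa using hr) hy.1 hyz hz.2
  simp at this; linarith

/-- If some arm has a nonnegative reward, then `V` is concave: allocations can be averaged, and
averaging before the cap on the crowd is only better. -/
theorem concaveOn {k : ι} (hk : k ∈ S) (hr : 0 ≤ r k) : ConcaveOn ℝ (Icc 0 N) V := by
  have hmono := hV.monotoneOn hγ0 hγ1 hN hg hk hr
  refine ⟨convex_Icc 0 N, ?_⟩
  have key : ∀ x ∈ {x : (ℝ × ℝ) × (ℝ × ℝ) | x.1.1 ∈ Icc 0 N ∧ x.1.2 ∈ Icc 0 N ∧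
      0 ≤ x.2.1 ∧ 0 ≤ x.2.2 ∧ x.2.1 + x.2.2 = 1},
      x.2.1 * V x.1.1 + x.2.2 * V x.1.2 - V (x.2.1 * x.1.1 + x.2.2 * x.1.2) ≤ 0 := by
    refine nonpos_of_le_discounted hγ0 hγ1 ?_ ?_
    · obtain ⟨b, hb⟩ := hV.bounded
      refine ⟨b + b, ?_⟩
      rintro ⟨⟨y, z⟩, ⟨s, t⟩⟩ ⟨h0, h1, h2, h3, h4⟩
      simp only at *
      have hm := (convex_Icc 0 N) h0 h1 h2 h3 h4
      have h5 := _root_.abs_le.1 (hb y h0)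
      have h6 := _root_.abs_le.1 (hb z h1)
      have h7 := _root_.abs_le.1 (hb _ hm)
      simp only [smul_eq_mul] at h7
      have ht : t = 1 - s := by linarith
      subst ht
      nlinarith
    · rintro ⟨⟨y, z⟩, ⟨s, t⟩⟩ ⟨h0, h1, h2, h3, h4⟩
      simp only at h0 h1 h2 h3 h4
      obtain ⟨m, hm, hmV⟩ := hV.attained y h0
      obtain ⟨m', hm', hmV'⟩ := hV.attained z h1
      obtain ⟨hw, hwm⟩ := next_mem hN hg hm
      obtain ⟨hw', hwm'⟩ := next_mem hN hg hm'
      have hmem := (convex_Icc 0 N) h0 h1 h2 h3 h4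
      have ha := add_mem_allocations (smul_mem_allocations h2 hm) (smul_mem_allocations h3 hm')
      have hge := hV.ge _ hmem _ ha
      refine ⟨((min (m ⬝ᵥ g) N, min (m' ⬝ᵥ g) N), (s, t)), ⟨hwm, hwm', h2, h3, h4⟩, ?_⟩
      simp only [add_dotProduct, smul_dotProduct, smul_eq_mul] at hge ⊢
      have hmem' := (convex_Icc 0 N) hwm hwm' h2 h3 h4
      simp only [smul_eq_mul] at hmem'
      have hcap : s * min (m ⬝ᵥ g) N + t * min (m' ⬝ᵥ g) N ≤
          min (s * (m ⬝ᵥ g) + t * (m' ⬝ᵥ g)) N :=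
        le_min (add_le_add (mul_le_mul_of_nonneg_left (min_le_left _ _) h2)
          (mul_le_mul_of_nonneg_left (min_le_left _ _) h3)) hmem'.2
      have hmo := hmono hmem' ⟨hmem'.1.trans hcap, min_le_right _ _⟩ hcap
      have := mul_le_mul_of_nonneg_left hmo hγ0
      rw [hmV, hmV']
      linarith
  intro y hy z hz s t hs ht hst
  have := key ((y, z), (s, t)) ⟨hy, hz, hs, ht, hst⟩
  simp only [smul_eq_mul] at this ⊢
  linarith

/-- If some arm has a nonnegative reward, then the value per unit of mass decreases. -/
theorem mul_le_mul_of_nonneg_reward {k : ι} (hk : k ∈ S) (hr : 0 ≤ r k) {y z : ℝ} (hy : 0 ≤ y)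
    (hyz : y ≤ z) (hz : z ≤ N) : y * V z ≤ z * V y := by
  rcases (hy.trans hyz).eq_or_lt with h | h
  · have : y = 0 := le_antisymm (by rw [h]; exact hyz) hy
    simp [this, ← h]
  · have := (hV.concaveOn hγ0 hγ1 hN hg hk hr).2 ⟨h.le, hz⟩ ⟨le_rfl, hN⟩
      (div_nonneg hy h.le) (sub_nonneg.2 ((div_le_one h).2 hyz)) (by ring)
    simp only [smul_eq_mul, mul_zero, add_zero, hV.zero hγ1 hN,
      div_mul_cancel₀ _ h.ne'] at this
    rw [div_mul_eq_mul_div, div_le_iff₀ h] at this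
    linarith

/-- If no arm has a positive reward, then the cost per unit of mass decreases: in a larger crowd
the same distribution over the arms can be used, and the cap on the crowd helps. -/
theorem mul_le_mul_of_nonpos_reward (hr : ∀ k ∈ S, r k ≤ 0) {y z : ℝ} (hy : 0 ≤ y)
    (hyz : y ≤ z) (hz : z ≤ N) : z * V y ≤ y * V z := by
  have hanti := hV.antitoneOn hγ0 hγ1 hN hg hr
  have h00 := hV.zero hγ1 hN
  have hnonpos : ∀ y ∈ Icc 0 N, V y ≤ 0 := fun y hy => by
    rw [← h00]; exact hanti ⟨le_rfl, hN⟩ hy hy.1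
  have key : ∀ x ∈ {x : ℝ × ℝ | x.1 ∈ Icc 0 N ∧ 1 ≤ x.2},
      x.2 * V x.1 - V (min (x.2 * x.1) N) ≤ 0 := by
    refine nonpos_of_le_discounted hγ0 hγ1 ?_ ?_
    · obtain ⟨b, hb⟩ := hV.bounded
      refine ⟨b, ?_⟩
      rintro ⟨y, c⟩ ⟨h0, h1⟩
      simp only at *
      have h2 : 0 ≤ c * y := mul_nonneg (by linarith) h0.1
      have h3 := _root_.abs_le.1 (hb (min (c * y) N) ⟨le_min h2 hN, min_le_right _ _⟩)
      have h4 := hnonpos y h0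
      nlinarith
    · rintro ⟨y, c⟩ ⟨h0, h1⟩
      simp only at h0 h1
      obtain ⟨m, hm, hmV⟩ := hV.attained y h0
      obtain ⟨hw, hwm⟩ := next_mem hN hg hm
      refine ⟨(min (m ⬝ᵥ g) N, c), ⟨hwm, h1⟩, ?_⟩
      simp only
      set w := m ⬝ᵥ g with hw_def
      have hcap : min (c * min w N) N = min (c * w) N := by
        rcases le_total w N with h | h
        · rw [min_eq_left h]
        · rw [min_eq_right h, min_eq_right, min_eq_right] <;> nlinarith
      rw [hcap]
      have hcy : 0 ≤ c * y := mul_nonneg (by linarith) h0.1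
      obtain ⟨d, hd0, hdc, hdy⟩ : ∃ d : ℝ, 0 ≤ d ∧ d ≤ c ∧ d * y = min (c * y) N := by
        rcases le_total (c * y) N with h | h
        · exact ⟨c, by linarith, le_rfl, (min_eq_left h).symm⟩
        · rcases h0.1.eq_or_lt with hy0 | hy0
          · refine ⟨c, by linarith, le_rfl, ?_⟩
            rw [← hy0, mul_zero, min_eq_left hN]
          · refine ⟨N / y, div_nonneg hN hy0.le, (div_le_iff₀ hy0).2 h, ?_⟩
            rw [min_eq_right h, div_mul_cancel₀ _ hy0.ne']
      have hge := hV.ge _ ⟨le_min hcy hN, min_le_right _ _⟩ (d • m)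
        (by rw [← hdy]; exact smul_mem_allocations hd0 hm)
      rw [smul_dotProduct, smul_dotProduct, smul_eq_mul, smul_eq_mul, ← hw_def] at hge
      have hmr : m ⬝ᵥ r ≤ 0 := by simpa using dotProduct_le_of_mem_allocations hm hr
      have h5 : c * (m ⬝ᵥ r) ≤ d * (m ⬝ᵥ r) := mul_le_mul_of_nonpos_right hdc hmr
      have h6 : V (min (c * w) N) ≤ V (min (d * w) N) :=
        hanti ⟨le_min (mul_nonneg hd0 hw) hN, min_le_right _ _⟩
          ⟨le_min (mul_nonneg (by linarith) hw) hN, min_le_right _ _⟩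
          (min_le_min_right _ (mul_le_mul_of_nonneg_right hdc hw))
      have h7 := mul_le_mul_of_nonneg_left h6 hγ0
      rw [hmV]
      linarith
  rcases hy.eq_or_lt with h | h
  · rw [← h, h00]; simp
  · have := key (y, z / y) ⟨⟨hy, hyz.trans hz⟩, (one_le_div h).2 hyz⟩
    simp only [div_mul_cancel₀ _ h.ne', min_eq_left hz] at this
    rw [div_mul_eq_mul_div, sub_nonpos, div_le_iff₀ h] at this
    linarith

end IsReducedValue

/-! ### Slopes of solutions of the reduced Bellman equation -/

/-- A nonnegative monotone function `U` with `U z / z` decreasing has slopes at most `U c / c`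
around `c`. -/
theorem abs_sub_le_of_starShaped {U : ℝ → ℝ} {N c z : ℝ} (hmono : MonotoneOn U (Icc 0 N))
    (hstar : ∀ {y z : ℝ}, 0 ≤ y → y ≤ z → z ≤ N → y * U z ≤ z * U y)
    (hc : 0 < c) (hcN : c ≤ N) (hz : z ∈ Icc 0 N) :
    |U z - U c| ≤ U c / c * |z - c| := by
  rw [div_mul_eq_mul_div, le_div_iff₀ hc]
  rcases le_total z c with h | h
  · have h1 := hmono hz ⟨hc.le, hcN⟩ h
    have h2 := hstar hz.1 h hcN
    rw [abs_sub_comm, abs_sub_comm z, abs_of_nonneg (sub_nonneg.2 h1),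
      abs_of_nonneg (sub_nonneg.2 h)]
    linarith
  · have h1 := hmono ⟨hc.le, hcN⟩ hz h
    have h2 := hstar hc.le h hz.2
    rw [abs_of_nonneg (sub_nonneg.2 h1), abs_of_nonneg (sub_nonneg.2 h)]
    linarith

namespace IsReducedValue

variable {ι : Type*} [Fintype ι] {S : Finset ι} {g r : ι → ℝ} {γ N : ℝ} {V : ℝ → ℝ}
section

variable (hV : IsReducedValue S g r γ N V) (hγ0 : 0 ≤ γ) (hN : 0 ≤ N) (hg : ∀ k ∈ S, 0 ≤ g k)
include hV hγ0 hN hg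

/-- If every linear function of slope at most `P` is improved by `f` per unit of mass in one
Bellman step, then the slope of `V` is at least `T * f` where the crowd remains below the cap
during `T` steps: an additional mass can be given in every step to the arm that realizes the
improvement. -/
theorem mul_le_sub_of_improvable {f P G : ℝ} (hG1 : 1 ≤ G) (hG : ∀ k ∈ S, g k ≤ G)
    (hmono : MonotoneOn V (Icc 0 N)) (hf : 0 ≤ f)
    (hfP : ∀ p, 0 ≤ p → p ≤ P → ∃ k ∈ S, p + f ≤ r k + γ * g k * p) (T : ℕ) (hT : T * f ≤ P)
    {w h : ℝ} (hw : 0 ≤ w) (hh : 0 ≤ h) (hcap : (w + h) * G ^ T ≤ N) :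
    h * (T * f) ≤ V (w + h) - V w := by
  classical
  induction T generalizing w h with
  | zero =>
    simp only [pow_zero, mul_one] at hcap
    have := hmono ⟨hw, by linarith⟩ ⟨by linarith, hcap⟩ (le_add_of_nonneg_right hh)
    simpa using this
  | succ T ih =>
    have hTf : (0 : ℝ) ≤ T * f := by positivity
    push_cast at hT
    have hTP : T * f ≤ P := by linarith
    obtain ⟨k, hk, hkr⟩ := hfP (T * f) hTf hTP
    have hwh : w + h ≤ N := by
      have : 1 ≤ G ^ (T + 1) := one_le_pow₀ hG1
      nlinarith
    obtain ⟨m, hm, hmV⟩ := hV.attained w ⟨hw, by linarith⟩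
    have hge := hV.ge (w + h) ⟨by linarith, hwh⟩ _
      (add_mem_allocations hm (single_mem_allocations hk hh))
    rw [add_dotProduct, add_dotProduct, single_dotProduct, single_dotProduct] at hge
    have hv0 := (next_mem hN hg hm).1
    have hvw := dotProduct_le_of_mem_allocations hm hG
    set v := m ⬝ᵥ g with hv
    have hgk := mul_nonneg hh (hg k hk)
    have hcap' : (v + h * g k) * G ^ T ≤ N := by
      refine le_trans ?_ hcap
      rw [pow_succ', ← mul_assoc]
      refine mul_le_mul_of_nonneg_right ?_ (by positivity)
      have := mul_le_mul_of_nonneg_left (hG k hk) hh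
      linarith
    have hcap'' : v + h * g k ≤ N := by
      have : 1 ≤ G ^ T := one_le_pow₀ hG1
      nlinarith
    have := ih hTP hv0 hgk hcap'
    rw [min_eq_left hcap''] at hge
    rw [min_eq_left (by linarith)] at hmV
    have h1 := mul_le_mul_of_nonneg_left this hγ0
    have h2 := mul_le_mul_of_nonneg_left hkr hh
    push_cast
    nlinarith

/-- If the slope of `V` is large below the crowd `δ * N`, then an optimal action either increases
the crowd by a factor `1 + c`, or leads to a crowd of at least `δ * N`: otherwise, moving mass to
the arm `k₀` of large growth would be an improvement. -/
theorem min_le_growth_of_attained {c R L δ : ℝ} (hδ1 : δ ≤ 1) (hc : 0 < c) {k₀ : ι} (hk₀ : k₀ ∈ S)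
    (hgk₀ : 1 + 2 * c ≤ g k₀) (hR : ∀ k ∈ S, |r k| ≤ R) (hLR : 2 * R < γ * L * c)
    (hslope : ∀ w h : ℝ, 0 ≤ w → 0 ≤ h → w + h ≤ δ * N → h * L ≤ V (w + h) - V w)
    {y : ℝ} (hy : y ∈ Icc 0 N) {m : ι → ℝ} (hm : m ∈ allocations S y)
    (hmV : V y = m ⬝ᵥ r + γ * V (min (m ⬝ᵥ g) N)) :
    min (y * (1 + c)) (δ * N) ≤ m ⬝ᵥ g := by
  classical
  by_contra hcon
  obtain ⟨hw1, hw2⟩ := lt_min_iff.1 (not_le.1 hcon)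
  have hw0 := (next_mem hN hg hm).1
  set w := m ⬝ᵥ g with hw_def
  have hy0 : 0 < y := by
    rcases hy.1.eq_or_lt with h | h
    · rw [← h] at hw1; linarith
    · exact h
  have hR0 : 0 ≤ R := (abs_nonneg _).trans (hR k₀ hk₀)
  have hδN : δ * N ≤ N := mul_le_of_le_one_left hN hδ1
  have hd : c * y ≤ y * g k₀ - w := by nlinarith
  have hcy : 0 < c * y := mul_pos hc hy0
  set d := y * g k₀ - w with hd_def
  have hd0 : 0 < d := by linarith
  set s := min 1 ((δ * N - w) / d) with hs
  have hs0 : 0 < s := lt_min one_pos (div_pos (by linarith) hd0)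
  have hs1 : s ≤ 1 := min_le_left _ _
  have hsd : s * d ≤ δ * N - w := (le_div_iff₀ hd0).1 (min_le_right _ _)
  have hm' := add_mem_allocations (smul_mem_allocations (sub_nonneg.2 hs1) hm)
    (single_mem_allocations hk₀ (mul_nonneg hs0.le hy.1))
  rw [show (1 - s) * y + s * y = y by ring] at hm'
  have hge := hV.ge y hy _ hm'
  rw [add_dotProduct, add_dotProduct, smul_dotProduct, smul_dotProduct, single_dotProduct,
    single_dotProduct, smul_eq_mul, smul_eq_mul, ← hw_def] at hge
  have hw' : (1 - s) * w + s * y * g k₀ = w + s * d := by rw [hd_def]; ring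
  rw [hw', min_eq_left (by linarith)] at hge
  rw [min_eq_left (by linarith)] at hmV
  have hsd0 : 0 ≤ s * d := mul_nonneg hs0.le hd0.le
  have h1 := mul_le_mul_of_nonneg_left (hslope w (s * d) hw0 hsd0 (by linarith)) hγ0
  have h2 := (_root_.abs_le.1 (abs_dotProduct_le_of_mem_allocations hm hR)).2
  have h3 : -R * (s * y) ≤ s * y * r k₀ := by
    have := mul_le_mul_of_nonneg_left (_root_.abs_le.1 (hR k₀ hk₀)).1 (mul_nonneg hs0.le hy.1)
    linarith
  have h4 : s * (m ⬝ᵥ r) ≤ s * (R * y) := mul_le_mul_of_nonneg_left h2 hs0.le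
  have hγL : 0 < γ * L := by
    by_contra h
    have := mul_nonpos_of_nonpos_of_nonneg (not_lt.1 h) hc.le
    linarith
  have h5 : γ * L * (s * (c * y)) ≤ γ * L * (s * d) :=
    mul_le_mul_of_nonneg_left (mul_le_mul_of_nonneg_left hd hs0.le) hγL.le
  have h6 : 2 * R * (s * y) < γ * L * c * (s * y) :=
    mul_lt_mul_of_pos_right hLR (mul_pos hs0 hy0)
  nlinarith

end

variable (hV : IsReducedValue S g r γ N V) (hγ0 : 0 ≤ γ) (hγ1 : γ < 1) (hN : 0 ≤ N)
  (hg : ∀ k ∈ S, 0 ≤ g k)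
include hV hγ0 hγ1 hN hg

theorem abs_sub_le {α β η L : ℝ} (hα : α ≤ 0) (hβ : 0 ≤ β) (hη : 0 ≤ η)
    (hβr : ∀ k ∈ S, r k + γ * g k * β ≤ β + η) {k : ι} (hk : k ∈ S)
    (hαr : α - η ≤ r k + γ * g k * α) (hL : β ≤ L) (hL' : -α ≤ L) {c z : ℝ}
    (hc : c ∈ Icc 0 N) (hz : z ∈ Icc 0 N) :
    |V z - V c| ≤ L * |z - c| + η * N / (1 - γ) := by
  have key : ∀ {c z : ℝ}, 0 ≤ c → c ≤ z → z ≤ N →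
      |V z - V c| ≤ L * |z - c| + η * N / (1 - γ) := by
    intro c z h0 h1 h2
    have h3 := hV.sub_le hγ0 hγ1 hN hg hβ hη hβr h0 h1 h2
    have h4 := hV.le_sub hγ0 hγ1 hN hg hα hη hk hαr h0 h1 h2
    rw [abs_of_nonneg (sub_nonneg.2 h1)]
    have h5 := mul_le_mul_of_nonneg_right hL (sub_nonneg.2 h1)
    have h6 := mul_le_mul_of_nonneg_right hL' (sub_nonneg.2 h1)
    exact _root_.abs_le.2 ⟨by linarith, by linarith⟩
  rcases le_total c z with h | h
  · exact key hc.1 h hz.2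
  · rw [abs_sub_comm, abs_sub_comm z]; exact key hz.1 h hc.2

/-- The value of an arbitrary action changes little when its growth is perturbed, in the presence
of an arm `k₀` of growth larger than `1`. The value function may be very steep at small crowds;
when the perturbed growth is small, it is therefore realized by moving mass to the arm `k₀`. -/
theorem reward_add_le_of_growth_le {c R ε : ℝ} (hc : 0 < c) {k₀ : ι} (hk₀ : k₀ ∈ S)
    (hgk₀ : 1 + 2 * c ≤ g k₀) (hR : ∀ k ∈ S, |r k| ≤ R) (hε : 0 ≤ ε) (hεc : ε ≤ c)
    {k : ι} (hk : k ∈ S) (hr : 0 ≤ r k) {y w : ℝ} (hy : y ∈ Icc 0 N) {m : ι → ℝ}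
    (hm : m ∈ allocations S y) (hw0 : 0 ≤ w) (hw : w ≤ m ⬝ᵥ g + ε * y) :
    m ⬝ᵥ r + γ * V (min w N) ≤ V y + (2 * R / c + R / (1 - γ)) * N * ε := by
  classical
  have hγ : 0 < 1 - γ := by linarith
  have hR0 : 0 ≤ R := (abs_nonneg _).trans (hR k hk)
  have hmono := hV.monotoneOn hγ0 hγ1 hN hg hk hr
  have hA : 0 ≤ 2 * R / c * N * ε := by positivity
  have hB : 0 ≤ R / (1 - γ) * N * ε := by positivity
  have hsum : (2 * R / c + R / (1 - γ)) * N * ε =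
    2 * R / c * N * ε + R / (1 - γ) * N * ε := by ring
  rw [hsum]
  have hv := next_mem hN hg hm
  have hge := hV.ge y hy m hm
  have hwm : min w N ∈ Icc 0 N := ⟨le_min hw0 hN, min_le_right _ _⟩
  set v := m ⬝ᵥ g with hv_def
  rcases le_or_gt w v with hwv | hwv
  · have := mul_le_mul_of_nonneg_left (hmono hwm hv.2 (min_le_min_right _ hwv)) hγ0
    linarith
  rcases le_or_gt v (y * (1 + c)) with hvy | hvy
  · set s := ε / c with hs
    have hs0 : 0 ≤ s := div_nonneg hε hc.le
    have hs1 : s ≤ 1 := (div_le_one hc).2 hεc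
    have hsc : s * c = ε := div_mul_cancel₀ _ hc.ne'
    have hm' := add_mem_allocations (smul_mem_allocations (sub_nonneg.2 hs1) hm)
      (single_mem_allocations hk₀ (mul_nonneg hs0 hy.1))
    rw [show (1 - s) * y + s * y = y by ring] at hm'
    have hge' := hV.ge y hy _ hm'
    rw [add_dotProduct, add_dotProduct, smul_dotProduct, smul_dotProduct, single_dotProduct,
      single_dotProduct, smul_eq_mul, smul_eq_mul, ← hv_def] at hge'
    have hd : c * y ≤ y * g k₀ - v := by nlinarith [hy.1]
    have hle : w ≤ (1 - s) * v + s * y * g k₀ := by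
      have := mul_le_mul_of_nonneg_left hd hs0
      have h2 : s * (c * y) = ε * y := by rw [← mul_assoc, hsc]
      nlinarith
    have h1 := mul_le_mul_of_nonneg_left (hmono hwm
      ⟨le_min (hw0.trans hle) hN, min_le_right _ _⟩ (min_le_min_right N hle)) hγ0
    have h2 := (_root_.abs_le.1 (abs_dotProduct_le_of_mem_allocations hm hR)).2
    have h3 : -R * (s * y) ≤ s * y * r k₀ := by
      have := mul_le_mul_of_nonneg_left (_root_.abs_le.1 (hR k₀ hk₀)).1 (mul_nonneg hs0 hy.1)
      linarith
    have h4 : s * (m ⬝ᵥ r) ≤ s * (R * y) := mul_le_mul_of_nonneg_left h2 hs0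
    have h5 : 2 * (R * (s * y)) ≤ 2 * R / c * N * ε := by
      have : 2 * R / c * N * ε = 2 * (R * (s * N)) := by rw [hs]; ring
      rw [this]
      have := mul_le_mul_of_nonneg_left hy.2 hs0
      have := mul_le_mul_of_nonneg_left this hR0
      linarith
    nlinarith
  · have hy0 : 0 < y := by
      rcases hy.1.eq_or_lt with h | h
      · rw [← h] at hw; linarith
      · exact h
    have hyv : y ≤ min v N := le_min (by nlinarith) hy.2
    have hc0 : 0 < min v N := hy0.trans_le hyv
    have h1 := abs_sub_le_of_starShaped hmono
      (hV.mul_le_mul_of_nonneg_reward hγ0 hγ1 hN hg hk hr) hc0 (min_le_right _ _) hwm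
    have h2 : |min w N - min v N| ≤ ε * y := by
      refine (abs_min_sub_min_le_max _ _ _ _).trans ?_
      rw [sub_self, abs_zero, max_eq_left (abs_nonneg _), abs_of_pos (by linarith)]
      linarith
    have h3 : V (min v N) / min v N ≤ R * N / (1 - γ) / y :=
      div_le_div₀ (by positivity)
        ((le_abs_self _).trans (hV.abs_le hγ0 hγ1 hN hg hR0 hR _ hv.2)) hy0 hyv
    have h4 : V (min v N) / min v N * |min w N - min v N| ≤ R * N / (1 - γ) / y * (ε * y) :=
      mul_le_mul h3 h2 (abs_nonneg _) (by positivity)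
    have h5 : R * N / (1 - γ) / y * (ε * y) = R / (1 - γ) * N * ε := by
      field_simp
    have h6 := (le_abs_self _).trans (h1.trans h4)
    rw [h5] at h6
    have h7 := mul_le_mul_of_nonneg_left h6 hγ0
    have h8 : γ * (R / (1 - γ) * N * ε) ≤ R / (1 - γ) * N * ε :=
      mul_le_of_le_one_left hB hγ1.le
    nlinarith

end IsReducedValue

/-! ### Dynamic programming for the reduced on-expectation MDP -/

namespace ROeMDP

variable {K : ℕ} {g r : Fin K → ℝ} {γ : ℝ} {N : ℕ} {π : ℝ → ℝ}

theorem dotProduct_le_of_mem_stdSimplex {a f : Fin K → ℝ} {b : ℝ} (ha : a ∈ stdSimplex ℝ (Fin K))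
    (hf : ∀ k, f k ≤ b) : a ⬝ᵥ f ≤ b := by
  simpa using dotProduct_le_of_mem_allocations (S := Finset.univ) (y := 1) (m := a)
    ⟨ha.1, by simp, ha.2⟩ fun k _ => hf k

theorem bddAbove_rewards (g r : Fin K → ℝ) (u : ℝ) :
    BddAbove {v | ∃ a ∈ stdSimplex ℝ (Fin K), ∑ k, a k * g k = u ∧ v = ∑ k, a k * r k} := by
  refine ⟨∑ k, |r k|, ?_⟩
  rintro _ ⟨a, ha, -, rfl⟩
  exact dotProduct_le_of_mem_stdSimplex ha fun k => (le_abs_self _).trans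
    (Finset.single_le_sum (f := fun k => |r k|) (fun _ _ => abs_nonneg _) (Finset.mem_univ k))

theorem le_reward {a : Fin K → ℝ} (ha : a ∈ stdSimplex ℝ (Fin K)) :
    a ⬝ᵥ r ≤ reward g r (a ⬝ᵥ g) :=
  le_csSup (bddAbove_rewards g r _) ⟨a, ha, rfl, rfl⟩

theorem reward_eq_of_mem_actions {u : ℝ} {a : Fin K → ℝ} (ha : a ∈ actions g r u) :
    reward g r u = a ⬝ᵥ r := by
  refine le_antisymm (csSup_le ⟨_, a, ha.1, ha.2.1, rfl⟩ ?_)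
    (le_csSup (bddAbove_rewards g r _) ⟨a, ha.1, ha.2.1, rfl⟩)
  rintro _ ⟨b, hb, hbu, rfl⟩
  exact ha.2.2 b hb hbu

theorem abs_reward_le {R : ℝ} (hR0 : 0 ≤ R) (hR : ∀ k, |r k| ≤ R) (u : ℝ) :
    |reward g r u| ≤ R := by
  have hup : ∀ v ∈ {v | ∃ a ∈ stdSimplex ℝ (Fin K), ∑ k, a k * g k = u ∧ v = ∑ k, a k * r k},
      |v| ≤ R := by
    rintro _ ⟨a, ha, -, rfl⟩
    have := abs_dotProduct_le_of_mem_allocations (S := Finset.univ) (y := 1) (m := a)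
      ⟨ha.1, by simp, ha.2⟩ fun k _ => hR k
    rwa [mul_one] at this
  rcases eq_empty_or_nonempty
    {v | ∃ a ∈ stdSimplex ℝ (Fin K), ∑ k, a k * g k = u ∧ v = ∑ k, a k * r k} with h | h
  · rw [reward, h, Real.sSup_empty]; simpa using hR0
  · obtain ⟨v, hv⟩ := h
    exact abs_le.2 ⟨(abs_le.1 (hup v hv)).1.trans (le_csSup (bddAbove_rewards g r u) hv),
      csSup_le ⟨v, hv⟩ fun w hw => (abs_le.1 (hup w hw)).2⟩

theorem growth_mem_Icc {a : Fin K → ℝ} (ha : a ∈ stdSimplex ℝ (Fin K)) :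
    a ⬝ᵥ g ∈ Icc (⨅ k, g k) (⨆ k, g k) := by
  constructor
  · have := dotProduct_le_of_mem_stdSimplex ha (f := -g) (b := -⨅ k, g k)
      fun k => neg_le_neg (ciInf_le (Finite.bddBelow_range g) k)
    rw [dotProduct_neg] at this
    linarith
  · exact dotProduct_le_of_mem_stdSimplex ha fun k => le_ciSup (Finite.bddAbove_range g) k

theorem exists_mem_stdSimplex_of_mem_Icc (hK : 0 < K) {u : ℝ}
    (hu : u ∈ Icc (⨅ k, g k) (⨆ k, g k)) : ∃ a ∈ stdSimplex ℝ (Fin K), a ⬝ᵥ g = u := by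
  have : Nonempty (Fin K) := ⟨⟨0, hK⟩⟩
  obtain ⟨i, hi⟩ := exists_eq_ciInf_of_finite (f := g)
  obtain ⟨j, hj⟩ := exists_eq_ciSup_of_finite (f := g)
  have himage : Convex ℝ ((fun a : Fin K → ℝ => a ⬝ᵥ g) '' stdSimplex ℝ (Fin K)) :=
    (convex_stdSimplex ℝ (Fin K)).is_linear_image
      ⟨fun a b => add_dotProduct a b g, fun c a => smul_dotProduct c a g⟩
  have h1 : (⨅ k, g k) ∈ (fun a : Fin K → ℝ => a ⬝ᵥ g) '' stdSimplex ℝ (Fin K) :=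
    ⟨Pi.single i 1, single_mem_stdSimplex ℝ i, by simp [hi]⟩
  have h2 : (⨆ k, g k) ∈ (fun a : Fin K → ℝ => a ⬝ᵥ g) '' stdSimplex ℝ (Fin K) :=
    ⟨Pi.single j 1, single_mem_stdSimplex ℝ j, by simp [hj]⟩
  exact himage.ordConnected.out h1 h2 hu

theorem path_succ' (N : ℕ) (π : ℝ → ℝ) (x : ℝ) (t : ℕ) :
    path N π x (t + 1) = path N π (min (x * π x) N) t := by
  induction t with
  | zero => rfl
  | succ t ih => rw [path, ih, path]

theorem mul_min_mem (hg : ∀ k, 0 ≤ g k) (hπ : IsPolicy g N π) {x : ℝ} (hx : x ∈ Icc (0 : ℝ) N) :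
    min (x * π x) N ∈ Icc (0 : ℝ) N :=
  ⟨le_min (mul_nonneg hx.1 ((Real.iInf_nonneg hg).trans (hπ x hx).1)) (Nat.cast_nonneg N),
    min_le_right _ _⟩

theorem path_mem (hg : ∀ k, 0 ≤ g k) (hπ : IsPolicy g N π) {x : ℝ} (hx : x ∈ Icc (0 : ℝ) N)
    (t : ℕ) : path N π x t ∈ Icc (0 : ℝ) N := by
  induction t with
  | zero => exact hx
  | succ t ih => exact mul_min_mem hg hπ ih

theorem isPolicy_const (k : Fin K) : IsPolicy g N fun _ => g k := fun _ _ =>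
  ⟨ciInf_le (Finite.bddBelow_range g) k, le_ciSup (Finite.bddAbove_range g) k⟩

theorem abs_value_term_le (hγ0 : 0 ≤ γ) (hg : ∀ k, 0 ≤ g k) {R : ℝ} (hR0 : 0 ≤ R)
    (hR : ∀ k, |r k| ≤ R) (hπ : IsPolicy g N π) {x : ℝ} (hx : x ∈ Icc (0 : ℝ) N) (t : ℕ) :
    ‖γ ^ t * (path N π x t * reward g r (π (path N π x t)))‖ ≤ γ ^ t * (N * R) := by
  obtain ⟨h0, h1⟩ := path_mem hg hπ hx t
  rw [Real.norm_eq_abs, abs_mul, abs_mul, abs_of_nonneg (pow_nonneg hγ0 t), abs_of_nonneg h0]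
  exact mul_le_mul_of_nonneg_left
    (mul_le_mul h1 (abs_reward_le hR0 hR _) (abs_nonneg _) (Nat.cast_nonneg N)) (pow_nonneg hγ0 t)

section Value

variable (hγ0 : 0 ≤ γ) (hγ1 : γ < 1) (hg : ∀ k, 0 ≤ g k)
include hγ0 hγ1 hg

theorem summable_value (r : Fin K → ℝ) (hπ : IsPolicy g N π) {x : ℝ} (hx : x ∈ Icc (0 : ℝ) N) :
    Summable fun t => γ ^ t * (path N π x t * reward g r (π (path N π x t))) := by
  refine Summable.of_norm_bounded
    ((summable_geometric_of_lt_one hγ0 hγ1).mul_right (N * ∑ k, |r k|))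
    (abs_value_term_le hγ0 hg (Finset.sum_nonneg fun _ _ => abs_nonneg _) (fun k => ?_) hπ hx)
  exact Finset.single_le_sum (f := fun k => |r k|) (fun _ _ => abs_nonneg _) (Finset.mem_univ k)

theorem abs_value_le (r : Fin K → ℝ) (hπ : IsPolicy g N π) {x : ℝ} (hx : x ∈ Icc (0 : ℝ) N) :
    |value g r γ N π x| ≤ (1 - γ)⁻¹ * (N * ∑ k, |r k|) := by
  have hgeom := (hasSum_geometric_of_lt_one hγ0 hγ1).mul_right (N * ∑ k, |r k|)
  refine tsum_of_norm_bounded hgeom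
    (abs_value_term_le hγ0 hg (Finset.sum_nonneg fun _ _ => abs_nonneg _) (fun k => ?_) hπ hx)
  exact Finset.single_le_sum (f := fun k => |r k|) (fun _ _ => abs_nonneg _) (Finset.mem_univ k)

theorem value_eq (r : Fin K → ℝ) (hπ : IsPolicy g N π) {x : ℝ} (hx : x ∈ Icc (0 : ℝ) N) :
    value g r γ N π x =
      x * reward g r (π x) + γ * value g r γ N π (min (x * π x) N) := by
  rw [value, (summable_value hγ0 hγ1 hg r hπ hx).tsum_eq_zero_add, value, ← tsum_mul_left]
  simp only [path_succ', pow_succ', pow_zero, one_mul, mul_assoc]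
  rfl

theorem bddAbove_values (r : Fin K → ℝ) {x : ℝ} (hx : x ∈ Icc (0 : ℝ) N) :
    BddAbove {v | ∃ π : ℝ → ℝ, IsPolicy g N π ∧ v = value g r γ N π x} := by
  refine ⟨(1 - γ)⁻¹ * (N * ∑ k, |r k|), ?_⟩
  rintro _ ⟨π, hπ, rfl⟩
  exact (le_abs_self _).trans (abs_value_le hγ0 hγ1 hg r hπ hx)

/-- The value of an optimal policy satisfies the Bellman inequality: otherwise, changing the policy
in one state would improve it. -/
theorem le_value_of_isOptimal (hπ : IsOptimal g r γ N π) {y u : ℝ} (hy : y ∈ Icc (0 : ℝ) N)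
    (hu : u ∈ Icc (⨅ k, g k) (⨆ k, g k)) :
    y * reward g r u + γ * value g r γ N π (min (y * u) N) ≤ value g r γ N π y := by
  classical
  by_contra! hcon
  set π' := Function.update π y u with hπ'_def
  have hy' : π' y = u := Function.update_self ..
  have hπ' : IsPolicy g N π' := by
    intro z hz
    by_cases h : z = y
    · rw [h, hy']; exact hu
    · rw [hπ'_def, Function.update_of_ne h]; exact hπ.1 z hz
  have key : ∀ z ∈ Icc (0 : ℝ) N, value g r γ N π z - value g r γ N π' z ≤ 0 := by
    refine nonpos_of_le_discounted hγ0 hγ1 ?_ ?_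
    · refine ⟨2 * ((1 - γ)⁻¹ * (N * ∑ k, |r k|)), fun z hz => ?_⟩
      have h1 := abs_le.1 (abs_value_le hγ0 hγ1 hg r hπ.1 hz)
      have h2 := abs_le.1 (abs_value_le hγ0 hγ1 hg r hπ' hz)
      linarith
    · intro z hz
      refine ⟨min (z * π' z) N, mul_min_mem hg hπ' hz, ?_⟩
      rw [value_eq hγ0 hγ1 hg r hπ' hz]
      have : value g r γ N π z ≤
          z * reward g r (π' z) + γ * value g r γ N π (min (z * π' z) N) := by
        by_cases h : z = y
        · rw [h, hy']; exact hcon.le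
        · rw [hπ'_def, Function.update_of_ne h, ← value_eq hγ0 hγ1 hg r hπ.1 hz]
      linarith
  have h1 := value_eq hγ0 hγ1 hg r hπ' hy
  have h2 := key _ (mul_min_mem hg hπ' hy)
  have h3 : value g r γ N π' y ≤ value g r γ N π y := by
    rw [hπ.2 y hy]
    exact le_csSup (bddAbove_values hγ0 hγ1 hg r hy) ⟨π', hπ', rfl⟩
  rw [hy'] at h1 h2
  have h4 := mul_le_mul_of_nonneg_left h2 hγ0
  linarith

/-- The value of an optimal policy solves the Bellman equation of the reduced MDP restricted to any
set of arms that contains the arms played in the nonempty states. -/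
theorem isReducedValue_of_isOptimal (hπ : IsOptimal g r γ N π) {ψ : ℝ → Fin K → ℝ}
    (hψ : ∀ y ∈ Icc (0 : ℝ) N, ψ y ∈ actions g r (π y)) {S : Finset (Fin K)}
    (hS : ∀ y ∈ Ioc (0 : ℝ) N, ∀ k, 0 < ψ y k → k ∈ S) :
    IsReducedValue S g r γ N (value g r γ N π) ∧
      ∀ y ∈ Ioc (0 : ℝ) N, y • ψ y ∈ allocations S y ∧ value g r γ N π y =
        (y • ψ y) ⬝ᵥ r + γ * value g r γ N π (min ((y • ψ y) ⬝ᵥ g) N) := by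
  have hzero := value_eq hγ0 hγ1 hg r hπ.1 (x := 0) ⟨le_rfl, Nat.cast_nonneg N⟩
  rw [zero_mul, zero_mul] at hzero
  have hpos : ∀ y ∈ Ioc (0 : ℝ) N, y • ψ y ∈ allocations S y ∧ value g r γ N π y =
        (y • ψ y) ⬝ᵥ r + γ * value g r γ N π (min ((y • ψ y) ⬝ᵥ g) N) := by
    intro y hy
    have hy' : y ∈ Icc (0 : ℝ) N := ⟨hy.1.le, hy.2⟩
    obtain ⟨h1, h2, -⟩ := hψ y hy'
    refine ⟨?_, ?_⟩
    · have := smul_mem_allocations (S := S) (y := 1) (m := ψ y) hy.1.le ⟨h1.1, fun k hk => ?_, h1.2⟩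
      · rwa [mul_one] at this
      · exact le_antisymm (not_lt.1 fun h => hk (hS y hy k h)) (h1.1 k)
    · rw [value_eq hγ0 hγ1 hg r hπ.1 hy', reward_eq_of_mem_actions (hψ y hy'), smul_dotProduct,
        smul_dotProduct, smul_eq_mul, smul_eq_mul, show ψ y ⬝ᵥ g = π y from h2]
  refine ⟨⟨⟨_, fun y hy => abs_value_le hγ0 hγ1 hg r hπ.1 hy⟩, fun y hy m hm => ?_,
    fun y hy => ?_⟩, hpos⟩
  · rcases hy.1.eq_or_lt with h | h
    · rw [← h] at hm
      rw [← h, eq_zero_of_mem_allocations_zero hm, zero_dotProduct, zero_dotProduct]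
      exact hzero.ge
    · have ha : y⁻¹ • m ∈ stdSimplex ℝ (Fin K) := by
        have := smul_mem_allocations (inv_nonneg.2 h.le) hm
        rw [inv_mul_cancel₀ h.ne'] at this
        exact ⟨this.1, this.2.2⟩
      have h1 := le_value_of_isOptimal hγ0 hγ1 hg hπ hy (growth_mem_Icc (g := g) ha)
      have h2 := mul_le_mul_of_nonneg_left (le_reward (g := g) (r := r) ha) h.le
      simp only [smul_dotProduct, smul_eq_mul, mul_inv_cancel_left₀ h.ne'] at h1 h2
      linarith
  · rcases hy.1.eq_or_lt with h | h
    · refine ⟨0, h ▸ zero_mem_allocations, ?_⟩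
      rw [← h, zero_dotProduct, zero_dotProduct]
      exact hzero
    · exact ⟨_, hpos y ⟨h, hy.2⟩⟩

theorem abs_optValue_le_maxValue (hK : 0 < K) (r : Fin K → ℝ) :
    |optValue g r γ N N| ≤ maxValue g r γ N := by
  refine le_csSup ⟨(1 - γ)⁻¹ * (N * ∑ k, |r k|), ?_⟩
    ⟨(N : ℝ), ⟨Nat.cast_nonneg N, le_rfl⟩, rfl⟩
  rintro _ ⟨x, hx, rfl⟩
  have hmem : value g r γ N (fun _ => g ⟨0, hK⟩) x ∈
      {v | ∃ π : ℝ → ℝ, IsPolicy g N π ∧ v = value g r γ N π x} :=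
    ⟨_, isPolicy_const _, rfl⟩
  refine abs_le.2 ⟨?_, csSup_le ⟨_, hmem⟩ ?_⟩
  · exact (abs_le.1 (abs_value_le hγ0 hγ1 hg r (isPolicy_const _) hx)).1.trans
      (le_csSup (bddAbove_values hγ0 hγ1 hg r hx) hmem)
  · rintro _ ⟨π, hπ, rfl⟩
    exact (abs_le.1 (abs_value_le hγ0 hγ1 hg r hπ hx)).2

/-- The maximal value is at least of the order of the maximal crowd: if the largest expected reward
is positive, it can be earned in the first step and afterwards nothing is lost; if it is negative,
it is an upper bound for the first step and afterwards nothing is gained. -/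
theorem mul_abs_le_maxValue {k : Fin K} (hk : ∀ j, r j ≤ r k) :
    N * |r k| ≤ maxValue g r γ N := by
  have hK : 0 < K := k.pos
  refine le_trans ?_ (abs_optValue_le_maxValue hγ0 hγ1 hg hK r)
  have hNmem : (N : ℝ) ∈ Icc (0 : ℝ) N := ⟨Nat.cast_nonneg N, le_rfl⟩
  have hconst : IsPolicy g N fun _ => g k := isPolicy_const k
  rcases le_total 0 (r k) with h | h
  · rw [abs_of_nonneg h]
    refine le_trans ?_ (le_abs_self _)
    refine le_trans ?_ (le_csSup (bddAbove_values hγ0 hγ1 hg r hNmem) ⟨_, hconst, rfl⟩)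
    have hrew : r k ≤ reward g r (g k) := by
      have := le_reward (g := g) (r := r) (single_mem_stdSimplex ℝ k)
      simpa using this
    have hle := (summable_value hγ0 hγ1 hg r hconst hNmem).le_tsum 0 fun t _ =>
      mul_nonneg (pow_nonneg hγ0 t)
        (mul_nonneg (path_mem hg hconst hNmem t).1 (h.trans hrew))
    refine le_trans ?_ hle
    simp only [pow_zero, one_mul, path]
    exact mul_le_mul_of_nonneg_left hrew (Nat.cast_nonneg N)
  · rw [abs_of_nonpos h]
    have hrew : ∀ {u : ℝ}, u ∈ Icc (⨅ k, g k) (⨆ k, g k) → reward g r u ≤ r k := by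
      intro u hu
      obtain ⟨a, ha, hau⟩ := exists_mem_stdSimplex_of_mem_Icc hK hu
      refine csSup_le ⟨_, a, ha, hau, rfl⟩ ?_
      rintro _ ⟨b, hb, -, rfl⟩
      exact dotProduct_le_of_mem_stdSimplex hb hk
    have hopt : optValue g r γ N N ≤ N * r k := by
      refine csSup_le ⟨_, _, hconst, rfl⟩ ?_
      rintro _ ⟨π, hπ, rfl⟩
      have hsum := summable_value hγ0 hγ1 hg r hπ hNmem
      have hle := hsum.neg.le_tsum 0 fun t _ => by
        have hmem := path_mem hg hπ hNmem t
        have := mul_nonpos_of_nonneg_of_nonpos (pow_nonneg hγ0 t)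
          (mul_nonpos_of_nonneg_of_nonpos hmem.1 ((hrew (hπ _ hmem)).trans h))
        simp only [Left.nonneg_neg_iff]
        exact this
      rw [tsum_neg] at hle
      have h1 := mul_le_mul_of_nonneg_left (hrew (hπ _ hNmem)) (Nat.cast_nonneg N)
      simp only [pow_zero, one_mul, path] at hle
      rw [value]
      linarith
    have := neg_abs_le (optValue g r γ N N)
    nlinarith

end Value

end ROeMDP

/-! ### One step of the Populated MDP, and its policy evaluation -/

section ProductWeights

variable {ι κ : Type*} [Fintype ι] [Fintype κ] [DecidableEq ι]

theorem sum_prod_weights_mul (q : κ → ℝ) (F : ι → κ → ℝ) :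
    ∑ a : ι → κ, (∏ i, q (a i)) * ∏ i, F i (a i) = ∏ i, ∑ k, q k * F i k := by
  rw [Finset.prod_univ_sum, Fintype.piFinset_univ]
  simp only [Finset.prod_mul_distrib]

theorem sum_prod_weights_mul_apply {q : κ → ℝ} (hq : ∑ k, q k = 1) (f : κ → ℝ) (i : ι) :
    ∑ a : ι → κ, (∏ j, q (a j)) * f (a i) = ∑ k, q k * f k := by
  have h := sum_prod_weights_mul q fun j k => if j = i then f k else 1
  have h1 : ∀ a : ι → κ, ∏ j, (if j = i then f (a j) else 1) = f (a i) := fun a => by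
    rw [Finset.prod_ite_eq' Finset.univ i fun j => f (a j), if_pos (Finset.mem_univ i)]
  simp only [h1] at h
  rw [h, Finset.prod_eq_single i]
  · simp
  · intro j _ hj; simp [hj, hq]
  · simp

theorem sum_prod_weights_mul_apply_mul_apply {q : κ → ℝ} (hq : ∑ k, q k = 1) (f : κ → ℝ)
    {i j : ι} (hij : i ≠ j) :
    ∑ a : ι → κ, (∏ l, q (a l)) * (f (a i) * f (a j)) = (∑ k, q k * f k) * ∑ k, q k * f k := by
  have h := sum_prod_weights_mul q fun l k =>
    (if l = i then f k else 1) * (if l = j then f k else 1)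
  have h1 : ∀ a : ι → κ, ∏ l, ((if l = i then f (a l) else 1) * (if l = j then f (a l) else 1)) =
      f (a i) * f (a j) := fun a => by
    rw [Finset.prod_mul_distrib, Finset.prod_ite_eq' Finset.univ i fun j => f (a j),
      Finset.prod_ite_eq' Finset.univ j fun j => f (a j)]
    simp
  simp only [h1] at h
  rw [h, Finset.prod_eq_mul i j hij]
  · simp [hij, hij.symm]
  · rintro l - ⟨hi, hj⟩; simp [hi, hj, hq]
  · simp
  · simp

/-- The variance of a sum of independent centered variables, for a product of copies of a weight
on a finite type. -/
theorem sum_prod_weights_mul_sum_sq {n : ℕ} {q : κ → ℝ} (hq : ∑ k, q k = 1) {f : κ → ℝ}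
    (hf : ∑ k, q k * f k = 0) {e : Fin n → ι} (he : Function.Injective e) :
    ∑ a : ι → κ, (∏ l, q (a l)) * (∑ i, f (a (e i))) ^ 2 = n * ∑ k, q k * f k ^ 2 := by
  have h : ∀ i j : Fin n, ∑ a : ι → κ, (∏ l, q (a l)) * (f (a (e i)) * f (a (e j))) =
      if i = j then ∑ k, q k * f k ^ 2 else 0 := by
    intro i j
    split_ifs with hij
    · subst hij
      rw [← sum_prod_weights_mul_apply hq (fun k => f k ^ 2) (e i)]
      simp only [sq]
    · rw [sum_prod_weights_mul_apply_mul_apply hq f (he.ne hij), hf, mul_zero]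
  calc ∑ a : ι → κ, (∏ l, q (a l)) * (∑ i, f (a (e i))) ^ 2
      = ∑ a : ι → κ, ∑ i, ∑ j, (∏ l, q (a l)) * (f (a (e i)) * f (a (e j))) := by
        refine Finset.sum_congr rfl fun a _ => ?_
        rw [sq, Finset.sum_mul_sum, Finset.mul_sum]
        refine Finset.sum_congr rfl fun i _ => ?_
        rw [Finset.mul_sum]
    _ = ∑ i, ∑ j, ∑ a : ι → κ, (∏ l, q (a l)) * (f (a (e i)) * f (a (e j))) := by
        rw [Finset.sum_comm]
        refine Finset.sum_congr rfl fun i _ => ?_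
        rw [Finset.sum_comm]
    _ = n * ∑ k, q k * f k ^ 2 := by simp [h]

end ProductWeights

/-- One time step from the crowd `x`, with expected total reward `ρ` and law `p` of the next crowd,
realizes the allocation `m` up to the fluctuation of the total growth. -/
structure IsStep {K : ℕ} (S : Finset (Fin K)) (g r : Fin K → ℝ) (M : ℝ) {N : ℕ} (x : Fin (N + 1))
    (m : Fin K → ℝ) (ρ : ℝ) (p : Fin (N + 1) → ℝ) : Prop where
  mem : m ∈ allocations S (x : ℕ)
  reward : ρ = m ⬝ᵥ r
  nonneg : ∀ z, 0 ≤ p z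
  sum_eq_one : ∑ z, p z = 1
  mean : ∑ z, p z * ((z : ℕ) : ℝ) ≤ m ⬝ᵥ g
  second : ∑ z, p z * (((z : ℕ) : ℝ) - min (m ⬝ᵥ g) N) ^ 2 ≤ 2 * M ^ 2 * (x : ℕ)

namespace CrowdBandit

variable {K : ℕ} (B : CrowdBandit K) {N : ℕ}

instance (k : Fin K) : IsProbabilityMeasure (B.law k) := B.prob k

instance (x : Fin (N + 1)) (a : Fin N → Fin K) : IsProbabilityMeasure (B.batchLaw x a) := by
  unfold batchLaw; infer_instance

theorem growth_le_maxGrowth (k : Fin K) : ∀ᵐ o ∂(B.law k), o.1 ≤ B.maxGrowth := by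
  have h : {m : ℕ | ∀ k, ∀ᵐ o ∂(B.law k), o.1 ≤ m}.Nonempty := B.bounded_growth
  exact Nat.sInf_mem h k

theorem measurable_growth : Measurable fun o : ℕ × ℝ => (o.1 : ℝ) :=
  (measurable_from_top (f := fun n : ℕ => (n : ℝ))).comp measurable_fst

theorem growth_mem_Icc (k : Fin K) :
    ∀ᵐ o ∂(B.law k), (o.1 : ℝ) ∈ Icc (0 : ℝ) B.maxGrowth := by
  filter_upwards [B.growth_le_maxGrowth k] with o ho
  exact ⟨Nat.cast_nonneg _, by exact_mod_cast ho⟩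

theorem memLp_growth (k : Fin K) : MemLp (fun o : ℕ × ℝ => (o.1 : ℝ)) 2 (B.law k) :=
  memLp_of_bounded (B.growth_mem_Icc k) measurable_growth.aestronglyMeasurable 2

theorem meanGrowth_nonneg (k : Fin K) : 0 ≤ B.meanGrowth k :=
  integral_nonneg fun _ => Nat.cast_nonneg _

theorem meanGrowth_le_maxGrowth (k : Fin K) : B.meanGrowth k ≤ B.maxGrowth := by
  have h := integral_mono_ae ((B.memLp_growth k).integrable one_le_two)
    (integrable_const (B.maxGrowth : ℝ)) ((B.growth_mem_Icc k).mono fun o ho => ho.2)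
  rwa [integral_const, probReal_univ, one_smul] at h

theorem variance_growth_le (k : Fin K) :
    ProbabilityTheory.variance (fun o : ℕ × ℝ => (o.1 : ℝ)) (B.law k) ≤ (B.maxGrowth : ℝ) ^ 2 := by
  have h := ProbabilityTheory.variance_le_sub_mul_sub (B.growth_mem_Icc k)
    measurable_growth.aemeasurable
  refine h.trans ?_
  have h1 := B.meanGrowth_nonneg k
  have h2 := B.meanGrowth_le_maxGrowth k
  change (B.maxGrowth - B.meanGrowth k) * (B.meanGrowth k - 0) ≤ _
  nlinarith

theorem integral_sum_growth (x : Fin (N + 1)) (a : Fin N → Fin K) :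
    ∫ o, ∑ i, ((o i).1 : ℝ) ∂(B.batchLaw x a) = ∑ i, B.meanGrowth (armOf x a i) := by
  rw [batchLaw, integral_finsetSum]
  · exact Finset.sum_congr rfl fun i _ =>
      integral_comp_eval (μ := fun i => B.law (armOf x a i)) (i := i)
        (f := fun o : ℕ × ℝ => (o.1 : ℝ)) measurable_growth.aestronglyMeasurable
  · exact fun i _ => integrable_comp_eval (μ := fun i => B.law (armOf x a i)) (i := i)
      (f := fun o : ℕ × ℝ => (o.1 : ℝ))
      ((B.memLp_growth _).integrable one_le_two)

theorem memLp_sum_growth (x : Fin (N + 1)) (a : Fin N → Fin K) :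
    MemLp (fun o : Fin (x : ℕ) → ℕ × ℝ => ∑ i, ((o i).1 : ℝ)) 2 (B.batchLaw x a) :=
  memLp_finsetSum _ fun i _ =>
    (B.memLp_growth (armOf x a i)).comp_measurePreserving (measurePreserving_eval _ i)

theorem stepReward_eq (x : Fin (N + 1)) (a : Fin N → Fin K) :
    B.stepReward x a = ∑ i, B.meanReward (armOf x a i) := by
  rw [stepReward, batchLaw, integral_finsetSum]
  · exact Finset.sum_congr rfl fun i _ => integral_comp_eval
      (μ := fun i => B.law (armOf x a i)) (i := i)
      (f := fun o : ℕ × ℝ => o.2) (B.integrable_reward _).aestronglyMeasurable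
  · exact fun i _ => integrable_comp_eval (μ := fun i => B.law (armOf x a i)) (i := i)
      (f := fun o : ℕ × ℝ => o.2) (B.integrable_reward _)

theorem integral_sum_growth_sub_sq_le (x : Fin (N + 1)) (a : Fin N → Fin K) (c : ℝ) :
    ∫ o, (∑ i, ((o i).1 : ℝ) - c) ^ 2 ∂(B.batchLaw x a) ≤
      (x : ℕ) * (B.maxGrowth : ℝ) ^ 2 + (∑ i, B.meanGrowth (armOf x a i) - c) ^ 2 := by
  have hL := B.memLp_sum_growth x a
  set X : (Fin (x : ℕ) → ℕ × ℝ) → ℝ := fun o => ∑ i, ((o i).1 : ℝ) with hX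
  have hLc : MemLp (fun o => X o - c) 2 (B.batchLaw x a) := hL.sub (memLp_const c)
  have h1 := ProbabilityTheory.variance_eq_sub hLc
  have h2 : ProbabilityTheory.variance (fun o => X o - c) (B.batchLaw x a) =
      ∑ i, ProbabilityTheory.variance (fun o : ℕ × ℝ => (o.1 : ℝ)) (B.law (armOf x a i)) := by
    rw [ProbabilityTheory.variance_sub_const hL.aestronglyMeasurable c,
      ← ProbabilityTheory.variance_sum_pi (μ := fun i => B.law (armOf x a i))
        (X := fun _ o => (o.1 : ℝ)) fun i => B.memLp_growth _, batchLaw]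
    congr 1
    ext o
    simp [hX]
  have h5 : ∑ i, ProbabilityTheory.variance (fun o : ℕ × ℝ => (o.1 : ℝ)) (B.law (armOf x a i)) ≤
      (x : ℕ) * (B.maxGrowth : ℝ) ^ 2 := by
    refine (Finset.sum_le_sum fun i _ => B.variance_growth_le _).trans_eq ?_
    simp
  have h6 : ∫ o, (X o - c) ∂(B.batchLaw x a) = ∑ i, B.meanGrowth (armOf x a i) - c := by
    rw [integral_sub (hL.integrable one_le_two) (integrable_const c), integral_sum_growth]
    simp
  rw [h2, h6] at h1
  have h7 : ∫ o, (X o - c) ^ 2 ∂(B.batchLaw x a) =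
      ∫ o, ((fun o => X o - c) ^ 2) o ∂(B.batchLaw x a) := rfl
  rw [h7]
  linarith

theorem measurable_nextCrowd (n : ℕ) :
    Measurable (nextCrowd N : (Fin n → ℕ × ℝ) → Fin (N + 1)) := by
  have h : Measurable fun o : Fin n → ℕ × ℝ => ∑ i, (o i).1 := by fun_prop
  exact (measurable_from_top
    (f := fun s : ℕ => (⟨min s N, Nat.lt_succ_iff.mpr (min_le_right _ _)⟩ : Fin (N + 1)))).comp h

/-- The probability that the crowd `z` follows the crowd `x` under the action `a`. -/
noncomputable def stepProb (x : Fin (N + 1)) (a : Fin N → Fin K) (z : Fin (N + 1)) : ℝ :=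
  ((B.batchLaw x a).map (nextCrowd N)).real {z}

instance (x : Fin (N + 1)) (a : Fin N → Fin K) :
    IsProbabilityMeasure ((B.batchLaw x a).map (nextCrowd N)) :=
  Measure.isProbabilityMeasure_map (measurable_nextCrowd _).aemeasurable

theorem stepExpect_eq_sum (f : Fin (N + 1) → ℝ) (x : Fin (N + 1)) (a : Fin N → Fin K) :
    B.stepExpect f x a = ∑ z, B.stepProb x a z * f z := by
  rw [stepExpect, ← integral_map (φ := nextCrowd N) (measurable_nextCrowd _).aemeasurable
    (measurable_of_finite f).aestronglyMeasurable, integral_fintype Integrable.of_finite]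
  rfl

theorem stepProb_nonneg (x : Fin (N + 1)) (a : Fin N → Fin K) (z : Fin (N + 1)) :
    0 ≤ B.stepProb x a z := measureReal_nonneg

theorem sum_stepProb (x : Fin (N + 1)) (a : Fin N → Fin K) : ∑ z, B.stepProb x a z = 1 := by
  have h := B.stepExpect_eq_sum (fun _ => 1) x a
  rw [stepExpect] at h
  simpa using h.symm

theorem stepExpect_crowd_le (x : Fin (N + 1)) (a : Fin N → Fin K) :
    B.stepExpect (fun z => ((z : ℕ) : ℝ)) x a ≤ ∑ i, B.meanGrowth (armOf x a i) := by
  rw [← integral_sum_growth, stepExpect]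
  refine integral_mono_of_nonneg (Filter.Eventually.of_forall fun o => Nat.cast_nonneg _)
    ((B.memLp_sum_growth x a).integrable one_le_two) (Filter.Eventually.of_forall fun o => ?_)
  simp only [nextCrowd]
  exact_mod_cast min_le_left _ _

theorem stepExpect_sub_sq_le (x : Fin (N + 1)) (a : Fin N → Fin K) (c : ℝ) :
    B.stepExpect (fun z => (((z : ℕ) : ℝ) - min c N) ^ 2) x a ≤
      (x : ℕ) * (B.maxGrowth : ℝ) ^ 2 + (∑ i, B.meanGrowth (armOf x a i) - c) ^ 2 := by
  refine le_trans ?_ (B.integral_sum_growth_sub_sq_le x a c)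
  rw [stepExpect]
  refine integral_mono_of_nonneg (Filter.Eventually.of_forall fun o => sq_nonneg _)
    ((B.memLp_sum_growth x a).sub (memLp_const c)).integrable_sq
    (Filter.Eventually.of_forall fun o => ?_)
  simp only [nextCrowd]
  refine sq_le_sq.2 ?_
  push_cast
  refine (abs_min_sub_min_le_max _ _ _ _).trans ?_
  simp

/-- The allocation that corresponds to an action of the Populated MDP: the number of subjects that
receive each arm. -/
def countArms (x : Fin (N + 1)) (a : Fin N → Fin K) : Fin K → ℝ :=
  ∑ i, Pi.single (armOf x a i) 1

theorem countArms_dotProduct (x : Fin (N + 1)) (a : Fin N → Fin K) (f : Fin K → ℝ) :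
    countArms x a ⬝ᵥ f = ∑ i, f (armOf x a i) := by
  simp [countArms, sum_dotProduct]

theorem countArms_mem {S : Finset (Fin K)} (x : Fin (N + 1)) (a : Fin N → Fin K)
    (hS : ∀ i, armOf x a i ∈ S) : countArms x a ∈ allocations S (x : ℕ) := by
  refine ⟨fun k => ?_, fun k hk => ?_, ?_⟩
  · simp only [countArms, Finset.sum_apply]
    exact Finset.sum_nonneg fun i _ =>
      (Pi.single_nonneg.2 zero_le_one : (0 : Fin K → ℝ) ≤ Pi.single (armOf x a i) 1) k
  · simp only [countArms, Finset.sum_apply]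
    refine Finset.sum_eq_zero fun i _ => ?_
    have : k ≠ armOf x a i := fun h => hk (h ▸ hS i)
    simp [this]
  · have := countArms_dotProduct x a 1
    simpa [dotProduct] using this

theorem isStep_action {S : Finset (Fin K)} (x : Fin (N + 1)) (a : Fin N → Fin K)
    (hS : ∀ i, armOf x a i ∈ S) :
    IsStep S B.meanGrowth B.meanReward B.maxGrowth x (countArms x a) (B.stepReward x a)
      (B.stepProb x a) where
  mem := countArms_mem x a hS
  reward := by rw [stepReward_eq, countArms_dotProduct]
  nonneg := B.stepProb_nonneg x a
  sum_eq_one := B.sum_stepProb x a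
  mean := by
    rw [countArms_dotProduct, ← stepExpect_eq_sum B fun z => ((z : ℕ) : ℝ)]
    exact B.stepExpect_crowd_le x a
  second := by
    rw [← stepExpect_eq_sum B fun z => (((z : ℕ) : ℝ) - min (countArms x a ⬝ᵥ B.meanGrowth) N) ^ 2]
    refine (B.stepExpect_sub_sq_le x a _).trans ?_
    rw [countArms_dotProduct, sub_self]
    have : 0 ≤ (B.maxGrowth : ℝ) ^ 2 * (x : ℕ) := by positivity
    linarith

/-- A step of a policy that draws the arms of the subjects independently from the distribution `q`
realizes the allocation of the crowd according to `q`. The drawing of the arms contributes to the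
fluctuation of the growth as much as the growths themselves. -/
theorem isStep_mixed {S : Finset (Fin K)} (x : Fin (N + 1)) {q : Fin K → ℝ}
    (hq : q ∈ stdSimplex ℝ (Fin K)) (hmem : ((x : ℕ) : ℝ) • q ∈ allocations S (x : ℕ)) :
    IsStep S B.meanGrowth B.meanReward B.maxGrowth x (((x : ℕ) : ℝ) • q)
      (∑ a : Fin N → Fin K, (∏ i, q (a i)) * B.stepReward x a)
      (fun z => ∑ a : Fin N → Fin K, (∏ i, q (a i)) * B.stepProb x a z) := by
  have hw0 : ∀ a : Fin N → Fin K, 0 ≤ ∏ i, q (a i) := fun a =>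
    Finset.prod_nonneg fun i _ => hq.1 _
  have hw1 : ∑ a : Fin N → Fin K, ∏ i, q (a i) = 1 := by
    have := sum_prod_weights_mul (ι := Fin N) q fun _ _ => 1
    simpa [hq.2] using this
  have hexp : ∀ f : Fin (N + 1) → ℝ,
      ∑ z, (∑ a : Fin N → Fin K, (∏ i, q (a i)) * B.stepProb x a z) * f z =
        ∑ a : Fin N → Fin K, (∏ i, q (a i)) * B.stepExpect f x a := by
    intro f
    simp only [stepExpect_eq_sum, Finset.mul_sum, Finset.sum_mul]
    rw [Finset.sum_comm]
    simp only [mul_assoc]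
  have hlin : ∀ f : Fin K → ℝ, ∑ a : Fin N → Fin K, (∏ i, q (a i)) * ∑ i, f (armOf x a i) =
      (((x : ℕ) : ℝ) • q) ⬝ᵥ f := by
    intro f
    simp only [Finset.mul_sum]
    rw [Finset.sum_comm]
    have : ∀ i : Fin (x : ℕ), ∑ a : Fin N → Fin K, (∏ i, q (a i)) * f (armOf x a i) = q ⬝ᵥ f :=
      fun i => sum_prod_weights_mul_apply hq.2 f _
    simp [this]
  refine ⟨hmem, ?_, fun z => Finset.sum_nonneg fun a _ =>
    mul_nonneg (hw0 a) (B.stepProb_nonneg x a z), ?_, ?_, ?_⟩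
  · rw [← hlin]
    simp only [stepReward_eq]
  · have := hexp fun _ => 1
    simp only [stepExpect_eq_sum, mul_one, sum_stepProb, hw1] at this
    exact this
  · rw [hexp fun z => ((z : ℕ) : ℝ), ← hlin]
    exact Finset.sum_le_sum fun a _ =>
      mul_le_mul_of_nonneg_left (B.stepExpect_crowd_le x a) (hw0 a)
  · rw [hexp fun z => (((z : ℕ) : ℝ) - min ((((x : ℕ) : ℝ) • q) ⬝ᵥ B.meanGrowth) N) ^ 2]
    have hu := ROeMDP.dotProduct_le_of_mem_stdSimplex hq B.meanGrowth_le_maxGrowth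
    have hu0 : 0 ≤ q ⬝ᵥ B.meanGrowth := Finset.sum_nonneg fun k _ =>
      mul_nonneg (hq.1 k) (B.meanGrowth_nonneg k)
    set u := q ⬝ᵥ B.meanGrowth with hu_def
    have hcent : ∑ k, q k * (B.meanGrowth k - u) = 0 := by
      simp only [mul_sub, Finset.sum_sub_distrib, ← Finset.sum_mul, hq.2, one_mul]
      exact sub_self _
    have hsq := sum_prod_weights_mul_sum_sq (ι := Fin N) (n := (x : ℕ)) hq.2 hcent
      (Fin.castLE_injective (Nat.lt_succ_iff.mp x.2))
    have hsq' : ∑ k, q k * (B.meanGrowth k - u) ^ 2 ≤ (B.maxGrowth : ℝ) ^ 2 := by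
      refine ROeMDP.dotProduct_le_of_mem_stdSimplex (f := fun k => (B.meanGrowth k - u) ^ 2) hq
        fun k => sq_le_sq' ?_ ?_
      · linarith [B.meanGrowth_nonneg k]
      · linarith [B.meanGrowth_le_maxGrowth k]
    have hmean : ∀ a : Fin N → Fin K,
        ∑ i, B.meanGrowth (armOf x a i) - (((x : ℕ) : ℝ) • q) ⬝ᵥ B.meanGrowth =
          ∑ i : Fin (x : ℕ), (B.meanGrowth (a (Fin.castLE (Nat.lt_succ_iff.mp x.2) i)) - u) := by
      intro a
      rw [smul_dotProduct, Finset.sum_sub_distrib]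
      simp [armOf, hu_def]
    calc _ ≤ ∑ a : Fin N → Fin K, (∏ i, q (a i)) * ((x : ℕ) * (B.maxGrowth : ℝ) ^ 2 +
          (∑ i : Fin (x : ℕ),
            (B.meanGrowth (a (Fin.castLE (Nat.lt_succ_iff.mp x.2) i)) - u)) ^ 2) := by
          refine Finset.sum_le_sum fun a _ => mul_le_mul_of_nonneg_left ?_ (hw0 a)
          rw [← hmean]
          exact B.stepExpect_sub_sq_le x a _
      _ = (x : ℕ) * (B.maxGrowth : ℝ) ^ 2 +
          (x : ℕ) * ∑ k, q k * (B.meanGrowth k - u) ^ 2 := by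
          simp only [mul_add, Finset.sum_add_distrib, ← Finset.sum_mul, hw1, one_mul]
          rw [hsq]
      _ ≤ 2 * (B.maxGrowth : ℝ) ^ 2 * (x : ℕ) := by
          have := mul_le_mul_of_nonneg_left hsq' (Nat.cast_nonneg (α := ℝ) (x : ℕ))
          linarith

section Value

variable {γ : ℝ} {σ : Fin (N + 1) → (Fin N → Fin K) → ℝ}

/-- The transition matrix of the crowd under the policy `σ`. -/
noncomputable def policyProb (σ : Fin (N + 1) → (Fin N → Fin K) → ℝ) (x z : Fin (N + 1)) : ℝ :=
  ∑ a, σ x a * B.stepProb x a z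

theorem sum_policy_stepExpect (σ : Fin (N + 1) → (Fin N → Fin K) → ℝ) (f : Fin (N + 1) → ℝ)
    (x : Fin (N + 1)) :
    ∑ a, σ x a * B.stepExpect f x a = ∑ z, B.policyProb σ x z * f z := by
  simp only [stepExpect_eq_sum, policyProb, Finset.mul_sum, Finset.sum_mul]
  rw [Finset.sum_comm]
  simp only [mul_assoc]

theorem policyProb_nonneg (hσ : IsPolicy σ) (x z : Fin (N + 1)) : 0 ≤ B.policyProb σ x z :=
  Finset.sum_nonneg fun a _ => mul_nonneg ((hσ x).1 a) (B.stepProb_nonneg x a z)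

theorem sum_policyProb (hσ : IsPolicy σ) (x : Fin (N + 1)) : ∑ z, B.policyProb σ x z = 1 := by
  have h := B.sum_policy_stepExpect σ (fun _ => 1) x
  simp only [stepExpect_eq_sum, mul_one, sum_stepProb, (hσ x).2] at h
  exact h.symm

theorem abs_expReward_le (hσ : IsPolicy σ) {R : ℝ} (hR : ∀ k, |B.meanReward k| ≤ R) (hR0 : 0 ≤ R)
    (t : ℕ) (x : Fin (N + 1)) : |B.expReward σ t x| ≤ N * R := by
  induction t generalizing x with
  | zero =>
    rw [expReward]
    have h : ∀ a, |B.stepReward x a| ≤ N * R := by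
      intro a
      rw [stepReward_eq]
      calc |∑ i, B.meanReward (armOf x a i)| ≤ ∑ i, |B.meanReward (armOf x a i)| :=
            Finset.abs_sum_le_sum_abs _ _
        _ ≤ ∑ i : Fin (x : ℕ), R := Finset.sum_le_sum fun i _ => hR _
        _ = (x : ℕ) * R := by simp
        _ ≤ N * R := mul_le_mul_of_nonneg_right
            (by exact_mod_cast Nat.lt_succ_iff.mp x.2) hR0
    have := abs_dotProduct_le_of_mem_allocations (S := Finset.univ) (y := 1) (m := σ x)
      (f := B.stepReward x) ⟨(hσ x).1, by simp, (hσ x).2⟩ fun a _ => h a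
    rwa [mul_one] at this
  | succ t ih =>
    rw [expReward, sum_policy_stepExpect]
    have := abs_dotProduct_le_of_mem_allocations (S := Finset.univ) (y := 1)
      (m := B.policyProb σ x) (f := B.expReward σ t)
      ⟨B.policyProb_nonneg hσ x, by simp, B.sum_policyProb hσ x⟩ fun z _ => ih z
    rwa [mul_one] at this

variable (hγ0 : 0 ≤ γ) (hγ1 : γ < 1)
include hγ0 hγ1

theorem summable_value (hσ : IsPolicy σ) (x : Fin (N + 1)) :
    Summable fun t : ℕ => γ ^ t * B.expReward σ t x := by
  refine Summable.of_norm_bounded ((summable_geometric_of_lt_one hγ0 hγ1).mul_right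
    (N * ∑ k, |B.meanReward k|)) fun t => ?_
  rw [Real.norm_eq_abs, abs_mul, abs_of_nonneg (pow_nonneg hγ0 t)]
  exact mul_le_mul_of_nonneg_left (B.abs_expReward_le hσ (fun k => Finset.single_le_sum
    (f := fun k => |B.meanReward k|) (fun _ _ => abs_nonneg _) (Finset.mem_univ k))
    (Finset.sum_nonneg fun _ _ => abs_nonneg _) t x) (pow_nonneg hγ0 t)

theorem value_eq (hσ : IsPolicy σ) (x : Fin (N + 1)) :
    B.value γ σ x = ∑ a, σ x a * B.stepReward x a +
      γ * ∑ z, B.policyProb σ x z * B.value γ σ z := by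
  rw [value, (B.summable_value hγ0 hγ1 hσ x).tsum_eq_zero_add]
  congr 1
  · simp [expReward]
  · simp only [expReward, sum_policy_stepExpect, value]
    simp_rw [← tsum_mul_left]
    rw [← Summable.tsum_finsetSum
      fun z _ => (B.summable_value hγ0 hγ1 hσ z).mul_left (B.policyProb σ x z), ← tsum_mul_left]
    refine tsum_congr fun t => ?_
    rw [pow_succ', mul_assoc, Finset.mul_sum]
    congr 1
    refine Finset.sum_congr rfl fun z _ => ?_
    ring

/-- A superharmonic function bounds the value of a policy from above. -/
theorem value_le_of_superharmonic (hσ : IsPolicy σ) {H : Fin (N + 1) → ℝ}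
    (hH : ∀ x, ∑ a, σ x a * (B.stepReward x a + γ * B.stepExpect H x a) ≤ H x) (x : Fin (N + 1)) :
    B.value γ σ x ≤ H x := by
  have key : ∀ x ∈ (univ : Set (Fin (N + 1))), B.value γ σ x - H x ≤ 0 := by
    obtain ⟨x₀, hx₀⟩ := Finite.exists_max fun x => B.value γ σ x - H x
    refine nonpos_of_le_discounted hγ0 hγ1 ⟨_, fun x _ => hx₀ x⟩ fun x _ => ⟨x₀, mem_univ _, ?_⟩
    have h1 := hH x
    simp only [mul_add, Finset.sum_add_distrib, mul_left_comm _ γ, ← Finset.mul_sum,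
      sum_policy_stepExpect] at h1
    have h2 : ∑ z, B.policyProb σ x z * (B.value γ σ z - H z) ≤ B.value γ σ x₀ - H x₀ := by
      calc _ ≤ ∑ z, B.policyProb σ x z * (B.value γ σ x₀ - H x₀) :=
            Finset.sum_le_sum fun z _ =>
              mul_le_mul_of_nonneg_left (hx₀ z) (B.policyProb_nonneg hσ x z)
        _ = _ := by rw [← Finset.sum_mul, B.sum_policyProb hσ, one_mul]
    simp only [mul_sub, Finset.sum_sub_distrib] at h2
    have h3 := mul_le_mul_of_nonneg_left h2 hγ0
    rw [B.value_eq hγ0 hγ1 hσ x]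
    linarith
  linarith [key x (mem_univ x)]

/-- A subharmonic function bounds the value of a policy from below. -/
theorem le_value_of_subharmonic (hσ : IsPolicy σ) {H : Fin (N + 1) → ℝ}
    (hH : ∀ x, H x ≤ ∑ a, σ x a * (B.stepReward x a + γ * B.stepExpect H x a)) (x : Fin (N + 1)) :
    H x ≤ B.value γ σ x := by
  have key : ∀ x ∈ (univ : Set (Fin (N + 1))), H x - B.value γ σ x ≤ 0 := by
    obtain ⟨x₀, hx₀⟩ := Finite.exists_max fun x => H x - B.value γ σ x
    refine nonpos_of_le_discounted hγ0 hγ1 ⟨_, fun x _ => hx₀ x⟩ fun x _ => ⟨x₀, mem_univ _, ?_⟩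
    have h1 := hH x
    simp only [mul_add, Finset.sum_add_distrib, mul_left_comm _ γ, ← Finset.mul_sum,
      sum_policy_stepExpect] at h1
    have h2 : ∑ z, B.policyProb σ x z * (H z - B.value γ σ z) ≤ H x₀ - B.value γ σ x₀ := by
      calc _ ≤ ∑ z, B.policyProb σ x z * (H x₀ - B.value γ σ x₀) :=
            Finset.sum_le_sum fun z _ =>
              mul_le_mul_of_nonneg_left (hx₀ z) (B.policyProb_nonneg hσ x z)
        _ = _ := by rw [← Finset.sum_mul, B.sum_policyProb hσ, one_mul]
    simp only [mul_sub, Finset.sum_sub_distrib] at h2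
    have h3 := mul_le_mul_of_nonneg_left h2 hγ0
    rw [B.value_eq hγ0 hγ1 hσ x]
    linarith
  linarith [key x (mem_univ x)]

theorem abs_value_le (hσ : IsPolicy σ) {R : ℝ} (hR : ∀ k, |B.meanReward k| ≤ R) (hR0 : 0 ≤ R)
    (x : Fin (N + 1)) : |B.value γ σ x| ≤ (1 - γ)⁻¹ * (N * R) := by
  refine tsum_of_norm_bounded (f := fun t : ℕ => γ ^ t * B.expReward σ t x)
    ((hasSum_geometric_of_lt_one hγ0 hγ1).mul_right (N * R)) fun t => ?_
  rw [Real.norm_eq_abs, abs_mul, abs_of_nonneg (pow_nonneg hγ0 t)]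
  exact mul_le_mul_of_nonneg_left (B.abs_expReward_le hσ hR hR0 t x) (pow_nonneg hγ0 t)

theorem value_le_optValue (hσ : IsPolicy σ) (x : Fin (N + 1)) :
    B.value γ σ x ≤ B.optValue γ x := by
  refine le_csSup ⟨(1 - γ)⁻¹ * (N * ∑ k, |B.meanReward k|), ?_⟩ ⟨σ, hσ, rfl⟩
  rintro _ ⟨τ, hτ, rfl⟩
  exact (le_abs_self _).trans (B.abs_value_le hγ0 hγ1 hτ (fun k => Finset.single_le_sum
    (f := fun k => |B.meanReward k|) (fun _ _ => abs_nonneg _) (Finset.mem_univ k))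
    (Finset.sum_nonneg fun _ _ => abs_nonneg _) x)

end Value

theorem isPolicy_mixedPolicy {ψ : ℝ → Fin K → ℝ}
    (hψ : ∀ y ∈ Icc (0 : ℝ) N, ψ y ∈ stdSimplex ℝ (Fin K)) : IsPolicy (mixedPolicy N ψ) := by
  intro x
  have hx := hψ (x : ℕ) ⟨Nat.cast_nonneg _, by exact_mod_cast Nat.lt_succ_iff.mp x.2⟩
  refine ⟨fun a => Finset.prod_nonneg fun i _ => hx.1 _, ?_⟩
  have := sum_prod_weights_mul (ι := Fin N) (ψ (x : ℕ)) fun _ _ => 1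
  simpa [hx.2, mixedPolicy] using this

end CrowdBandit

/-! ### Errors of one step, and the potential of a growing crowd -/

namespace IsStep

variable {K : ℕ} {S : Finset (Fin K)} {g r g' r' : Fin K → ℝ} {M ε γ : ℝ} {N : ℕ}
  {x : Fin (N + 1)} {m : Fin K → ℝ} {ρ : ℝ} {p : Fin (N + 1) → ℝ} {V : ℝ → ℝ}

theorem cast_mem_Icc (x : Fin (N + 1)) : ((x : ℕ) : ℝ) ∈ Icc (0 : ℝ) N :=
  ⟨Nat.cast_nonneg _, by exact_mod_cast Nat.lt_succ_iff.mp x.2⟩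

theorem sum_le (h : IsStep S g r M x m ρ p) {f : Fin (N + 1) → ℝ} {b : ℝ} (hf : ∀ z, f z ≤ b) :
    ∑ z, p z * f z ≤ b := by
  calc ∑ z, p z * f z ≤ ∑ z, p z * b :=
        Finset.sum_le_sum fun z _ => mul_le_mul_of_nonneg_left (hf z) (h.nonneg z)
    _ = b := by rw [← Finset.sum_mul, h.sum_eq_one, one_mul]

theorem sum_abs_sub_le (h : IsStep S g r M x m ρ p) (hM : 0 ≤ M) :
    ∑ z, p z * |((z : ℕ) : ℝ) - min (m ⬝ᵥ g) N| ≤ M * √(2 * (x : ℕ)) := by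
  have h1 := Real.pow_arith_mean_le_arith_mean_pow Finset.univ p
    (fun z => |((z : ℕ) : ℝ) - min (m ⬝ᵥ g) N|) (fun z _ => h.nonneg z) h.sum_eq_one
    (fun z _ => abs_nonneg _) 2
  simp only [sq_abs] at h1
  have h2 : √(2 * M ^ 2 * (x : ℕ)) = M * √(2 * (x : ℕ)) := by
    rw [show 2 * M ^ 2 * ((x : ℕ) : ℝ) = M ^ 2 * (2 * (x : ℕ)) by ring,
      Real.sqrt_mul (sq_nonneg M), Real.sqrt_sq hM]
  rw [← h2]
  exact Real.le_sqrt_of_sq_le (h1.trans h.second)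

/-- The empty crowd earns nothing and remains empty. -/
theorem of_zero (h : IsStep S g r M x m ρ p) (hx : (x : ℕ) = 0) (V : ℝ → ℝ) :
    ρ = 0 ∧ ∑ z, p z * V (z : ℕ) = V 0 := by
  have hmem := h.mem
  rw [hx, Nat.cast_zero] at hmem
  have hm0 : m = 0 := eq_zero_of_mem_allocations_zero hmem
  refine ⟨by rw [h.reward, hm0, zero_dotProduct], ?_⟩
  have hs := h.second
  rw [hm0, zero_dotProduct, min_eq_left (Nat.cast_nonneg N), hx, Nat.cast_zero, mul_zero] at hs
  have hz := (Finset.sum_eq_zero_iff_of_nonneg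
    fun z _ => mul_nonneg (h.nonneg z) (sq_nonneg _)).1
      (le_antisymm hs (Finset.sum_nonneg fun z _ => mul_nonneg (h.nonneg z) (sq_nonneg _)))
  calc ∑ z, p z * V (z : ℕ) = ∑ z, p z * V 0 := by
        refine Finset.sum_congr rfl fun z hz' => ?_
        rcases mul_eq_zero.1 (hz z hz') with h0 | h0
        · rw [h0, zero_mul, zero_mul]
        · rw [sub_zero, sq_eq_zero_iff] at h0
          rw [h0]
    _ = V 0 := by rw [← Finset.sum_mul, h.sum_eq_one, one_mul]

/-- The error of one Bellman step is the sum of the error of the rewards, the fluctuation of the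
next crowd and the error of the growths. -/
theorem abs_sub_le (h : IsStep S g r M x m ρ p) (hγ0 : 0 ≤ γ) (hγ1 : γ < 1)
    (hr : ∀ k ∈ S, |r k - r' k| ≤ ε) (V : ℝ → ℝ) :
    |ρ + γ * ∑ z, p z * V (z : ℕ) - (m ⬝ᵥ r' + γ * V (min (m ⬝ᵥ g') N))| ≤
      ε * (x : ℕ) + (∑ z, p z * |V (z : ℕ) - V (min (m ⬝ᵥ g) N)| +
        |V (min (m ⬝ᵥ g') N) - V (min (m ⬝ᵥ g) N)|) := by
  have h1 := abs_dotProduct_sub_le_of_mem_allocations h.mem hr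
  have h2 : |∑ z, p z * V (z : ℕ) - V (min (m ⬝ᵥ g) N)| ≤
      ∑ z, p z * |V (z : ℕ) - V (min (m ⬝ᵥ g) N)| := by
    have : ∑ z, p z * V (z : ℕ) - V (min (m ⬝ᵥ g) N) =
        ∑ z, p z * (V (z : ℕ) - V (min (m ⬝ᵥ g) N)) := by
      simp only [mul_sub, Finset.sum_sub_distrib, ← Finset.sum_mul, h.sum_eq_one, one_mul]
    rw [this]
    refine (Finset.abs_sum_le_sum_abs _ _).trans_eq (Finset.sum_congr rfl fun z _ => ?_)
    rw [abs_mul, abs_of_nonneg (h.nonneg z)]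
  set E := ∑ z, p z * V (z : ℕ)
  set A := V (min (m ⬝ᵥ g) N)
  set A' := V (min (m ⬝ᵥ g') N)
  rw [h.reward]
  calc |m ⬝ᵥ r + γ * E - (m ⬝ᵥ r' + γ * A')|
      = |(m ⬝ᵥ r - m ⬝ᵥ r') + γ * ((E - A) - (A' - A))| := by ring_nf
    _ ≤ |m ⬝ᵥ r - m ⬝ᵥ r'| + γ * (|E - A| + |A' - A|) := by
        refine (abs_add_le _ _).trans ?_
        rw [abs_mul, abs_of_nonneg hγ0]
        gcongr
        exact abs_sub _ _
    _ ≤ _ := by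
        have h3 : γ * (|E - A| + |A' - A|) ≤ |E - A| + |A' - A| :=
          mul_le_of_le_one_left (by positivity) hγ1.le
        linarith

theorem abs_min_sub_min_le (h : IsStep S g r M x m ρ p) (hg : ∀ k ∈ S, |g k - g' k| ≤ ε) :
    |min (m ⬝ᵥ g') N - min (m ⬝ᵥ g) N| ≤ ε * (x : ℕ) := by
  refine (abs_min_sub_min_le_max _ _ _ _).trans ?_
  rw [sub_self, abs_zero, max_eq_left (abs_nonneg _), abs_sub_comm]
  exact abs_dotProduct_sub_le_of_mem_allocations h.mem hg

end IsStep

/-- The potential that accounts for the fluctuations of a crowd of size `y` which tends to grow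
until it reaches `D`; it is `A / √y` for `y ≤ D` as long as this is at most `1`, the trivial bound.
The junk value at `y = 0` is `0`, which is what the empty crowd requires. -/
noncomputable def crowdPotential (A D y : ℝ) : ℝ := min 1 (A / √(min y D))

theorem crowdPotential_nonneg {A D y : ℝ} (hA : 0 ≤ A) : 0 ≤ crowdPotential A D y :=
  le_min zero_le_one (div_nonneg hA (Real.sqrt_nonneg _))

/-- The discounted potential decreases by a constant factor if the crowd does not shrink in mean:
by Chebyshev's inequality, a crowd much smaller than its mean is improbable. -/
theorem exists_crowdPotential_contraction {γ δ : ℝ} (hγ0 : 0 ≤ γ) (hγ1 : γ < 1) (hδ0 : 0 < δ)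
    (hδ1 : δ ≤ 1) : ∃ A : ℝ, 1 ≤ A ∧ ∀ (M : ℝ) (N : ℕ) (x : Fin (N + 1)) (p : Fin (N + 1) → ℝ)
      (c : ℝ), 0 ≤ M → 0 < (x : ℕ) → (∀ z, 0 ≤ p z) → ∑ z, p z = 1 →
      ∑ z, p z * (((z : ℕ) : ℝ) - c) ^ 2 ≤ 2 * M ^ 2 * (x : ℕ) →
      min ((x : ℕ) : ℝ) (δ * N) ≤ c →
      γ * ∑ z, p z * crowdPotential (A * M) (δ * N) (z : ℕ) ≤
        (1 - (1 - γ) / 4) * crowdPotential (A * M) (δ * N) (x : ℕ) := by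
  set t := (1 + γ) / 2 with ht
  have ht0 : 0 < t := by linarith
  have ht1 : t < 1 := by linarith
  have htt : 0 < 1 - t ^ 2 := by nlinarith
  set D := 2 / (δ * (1 - t ^ 2) ^ 2) with hD
  have hD0 : 0 < D := by positivity
  have h1γ : 0 < 1 - γ := by linarith
  set A := 4 * D / (1 - γ) + 1 with hA
  have hA1 : 1 ≤ A := by
    have : 0 ≤ 4 * D / (1 - γ) := by positivity
    linarith
  have hA0 : 0 < A := by linarith
  refine ⟨A, hA1, ?_⟩
  intro M N x p c hM hx hp0 hp1 hvar hc
  have hx0 : (0 : ℝ) < (x : ℕ) := by exact_mod_cast hx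
  have hxN : ((x : ℕ) : ℝ) ≤ N := (IsStep.cast_mem_Icc x).2
  have hN0 : (0 : ℝ) < N := hx0.trans_le hxN
  set μ := min ((x : ℕ) : ℝ) (δ * N) with hμ
  have hμ0 : 0 < μ := lt_min hx0 (mul_pos hδ0 hN0)
  have hsμ : 0 < √μ := Real.sqrt_pos.2 hμ0
  have hAM : 0 ≤ A * M := mul_nonneg hA0.le hM
  have hφ1 : ∀ y, crowdPotential (A * M) (δ * N) y ≤ 1 := fun y => min_le_left _ _
  have hsum : ∀ f : Fin (N + 1) → ℝ, ∀ b, (∀ z, f z ≤ b) → ∑ z, p z * f z ≤ b := by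
    intro f b hf
    calc ∑ z, p z * f z ≤ ∑ z, p z * b :=
          Finset.sum_le_sum fun z _ => mul_le_mul_of_nonneg_left (hf z) (hp0 z)
      _ = b := by rw [← Finset.sum_mul, hp1, one_mul]
  rcases le_or_gt 1 (A * M / √μ) with hs | hs
  · have : crowdPotential (A * M) (δ * N) (x : ℕ) = 1 := min_eq_left hs
    rw [this]
    have := mul_le_mul_of_nonneg_left (hsum _ 1 fun z => hφ1 (z : ℕ)) hγ0
    linarith
  · have hφx : crowdPotential (A * M) (δ * N) (x : ℕ) = A * M / √μ := min_eq_right hs.le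
    rw [hφx]
    have hpt : ∀ z : Fin (N + 1), crowdPotential (A * M) (δ * N) (z : ℕ) ≤
        A * M / √μ / t + (((z : ℕ) : ℝ) - c) ^ 2 / ((1 - t ^ 2) * μ) ^ 2 := by
      intro z
      rcases le_or_gt (t ^ 2 * μ) ((z : ℕ) : ℝ) with hz | hz
      · have h1 : t * √μ ≤ √(min ((z : ℕ) : ℝ) (δ * N)) := by
          refine Real.le_sqrt_of_sq_le ?_
          rw [mul_pow, Real.sq_sqrt hμ0.le]
          refine le_min hz (le_trans ?_ (min_le_right ((x : ℕ) : ℝ) (δ * N)))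
          exact mul_le_of_le_one_left hμ0.le (by nlinarith)
        have h2 : crowdPotential (A * M) (δ * N) (z : ℕ) ≤ A * M / (t * √μ) :=
          (min_le_right _ _).trans (div_le_div_of_nonneg_left hAM (by positivity) h1)
        have h3 : A * M / (t * √μ) = A * M / √μ / t := by rw [div_div, mul_comm t]
        rw [h3] at h2
        have : 0 ≤ (((z : ℕ) : ℝ) - c) ^ 2 / ((1 - t ^ 2) * μ) ^ 2 := by positivity
        linarith
      · have h1 : (1 - t ^ 2) * μ ≤ c - (z : ℕ) := by linarith
        have h2 : ((1 - t ^ 2) * μ) ^ 2 ≤ (((z : ℕ) : ℝ) - c) ^ 2 := by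
          rw [← neg_sub c, neg_sq]
          exact pow_le_pow_left₀ (by positivity) h1 2
        have h3 : 1 ≤ (((z : ℕ) : ℝ) - c) ^ 2 / ((1 - t ^ 2) * μ) ^ 2 :=
          (one_le_div (by positivity)).2 h2
        have h4 : 0 ≤ A * M / √μ / t := by positivity
        linarith [hφ1 (z : ℕ)]
    have hE : ∑ z, p z * crowdPotential (A * M) (δ * N) (z : ℕ) ≤
        A * M / √μ / t + 2 * M ^ 2 * (x : ℕ) / ((1 - t ^ 2) * μ) ^ 2 := by
      calc _ ≤ ∑ z, p z * (A * M / √μ / t + (((z : ℕ) : ℝ) - c) ^ 2 / ((1 - t ^ 2) * μ) ^ 2) :=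
            Finset.sum_le_sum fun z _ => mul_le_mul_of_nonneg_left (hpt z) (hp0 z)
        _ = A * M / √μ / t +
            (∑ z, p z * (((z : ℕ) : ℝ) - c) ^ 2) / ((1 - t ^ 2) * μ) ^ 2 := by
            simp only [mul_add, Finset.sum_add_distrib, ← Finset.sum_mul, hp1, one_mul,
              Finset.sum_div, mul_div_assoc]
        _ ≤ _ := by gcongr
    have hxμ : δ * (x : ℕ) ≤ μ :=
      le_min (mul_le_of_le_one_left hx0.le hδ1) (mul_le_mul_of_nonneg_left hxN hδ0.le)
    -- the probability of a large deviation is of second order in the potential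
    have hdev : 2 * M ^ 2 * (x : ℕ) / ((1 - t ^ 2) * μ) ^ 2 ≤ (1 - γ) / 4 * (A * M / √μ) := by
      have h1 : 2 * M ^ 2 * (x : ℕ) / ((1 - t ^ 2) * μ) ^ 2 ≤ D * (M / √μ) ^ 2 := by
        rw [div_pow M, Real.sq_sqrt hμ0.le, hD, div_le_iff₀ (by positivity)]
        have : 2 / (δ * (1 - t ^ 2) ^ 2) * (M ^ 2 / μ) * ((1 - t ^ 2) * μ) ^ 2 =
            2 * M ^ 2 * (μ / δ) := by
          field_simp
        rw [this]
        have := (le_div_iff₀' hδ0).2 hxμ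
        gcongr
      have hs0 : 0 ≤ M / √μ := by positivity
      have h2 : A * (M / √μ) ≤ 1 := by rw [← mul_div_assoc]; exact hs.le
      have h3 : 4 * D ≤ (1 - γ) * A := by
        rw [hA, mul_add, mul_div_cancel₀ _ h1γ.ne']; linarith
      have h4 : D * (M / √μ) ^ 2 ≤ D * (M / √μ) := by
        have : M / √μ ≤ 1 := by nlinarith
        have : (M / √μ) ^ 2 ≤ M / √μ := by nlinarith
        exact mul_le_mul_of_nonneg_left this hD0.le
      have h5 : D * (M / √μ) ≤ (1 - γ) / 4 * A * (M / √μ) :=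
        mul_le_mul_of_nonneg_right (by linarith) hs0
      have h6 : (1 - γ) / 4 * A * (M / √μ) = (1 - γ) / 4 * (A * M / √μ) := by ring
      linarith
    have hγt : γ * (A * M / √μ / t) ≤ t * (A * M / √μ) := by
      have h1 : γ / t ≤ t := by
        rw [div_le_iff₀ ht0, ht]; nlinarith [sq_nonneg (1 - γ)]
      have h2 : γ * (A * M / √μ / t) = γ / t * (A * M / √μ) := by ring
      rw [h2]
      exact mul_le_mul_of_nonneg_right h1 (by positivity)
    have h7 : 0 ≤ (1 - γ) / 4 * (A * M / √μ) := by positivity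
    have h8 := mul_le_mul_of_nonneg_left (hE.trans (add_le_add_right hdev _)) hγ0
    have h9 : γ * ((1 - γ) / 4 * (A * M / √μ)) ≤ (1 - γ) / 4 * (A * M / √μ) :=
      mul_le_of_le_one_left h7 hγ1.le
    have h10 : t * (A * M / √μ) =
        (1 - (1 - γ) / 4) * (A * M / √μ) - (1 - γ) / 4 * (A * M / √μ) := by rw [ht]; ring
    linarith

/-! ### Corrections that absorb the errors of one step -/

/-- The upper half of the comparison for the arms in `S`: when the parameters are estimated with an
error `ε ≤ ε₀`, the solution of the estimated Bellman equation plus a correction `Φ` of the desired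
order is superharmonic for all actions of the Populated MDP. -/
def HasUpperComparison {K : ℕ} (S : Finset (Fin K)) (g r : Fin K → ℝ) (γ ε₀ C : ℝ) : Prop :=
  ∀ (g' r' : Fin K → ℝ) (ε M : ℝ) (N : ℕ) (V : ℝ → ℝ), 0 ≤ ε → ε ≤ ε₀ → 0 ≤ M →
    (∀ k ∈ S, 0 ≤ g' k) → (∀ k ∈ S, |g k - g' k| ≤ ε) → (∀ k ∈ S, |r k - r' k| ≤ ε) →
    IsReducedValue S g' r' γ N V →
    ∃ Φ : ℝ → ℝ, (∀ x : ℕ, 0 < x → x ≤ N → Φ x ≤ C * (N * (M / √x + ε))) ∧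
      ∀ (x : Fin (N + 1)) (m : Fin K → ℝ) (ρ : ℝ) (p : Fin (N + 1) → ℝ),
        IsStep S g r M x m ρ p →
        ρ + γ * ∑ z, p z * (V (z : ℕ) + Φ (z : ℕ)) ≤ V (x : ℕ) + Φ (x : ℕ)

/-- The lower half of the comparison for the arms in `S`: when the parameters are estimated with an
error `ε ≤ ε₀`, the solution of the estimated Bellman equation minus a correction `Φ` of the desired
order is subharmonic for the actions that are optimal for the estimated parameters. -/
def HasLowerComparison {K : ℕ} (S : Finset (Fin K)) (g r : Fin K → ℝ) (γ ε₀ C : ℝ) : Prop :=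
  ∀ (g' r' : Fin K → ℝ) (ε M : ℝ) (N : ℕ) (V : ℝ → ℝ), 0 ≤ ε → ε ≤ ε₀ → 0 ≤ M →
    (∀ k ∈ S, 0 ≤ g' k) → (∀ k ∈ S, |g k - g' k| ≤ ε) → (∀ k ∈ S, |r k - r' k| ≤ ε) →
    IsReducedValue S g' r' γ N V →
    ∃ Φ : ℝ → ℝ, (∀ x : ℕ, 0 < x → x ≤ N → Φ x ≤ C * (N * (M / √x + ε))) ∧
      ∀ (x : Fin (N + 1)) (m : Fin K → ℝ) (ρ : ℝ) (p : Fin (N + 1) → ℝ),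
        IsStep S g r M x m ρ p →
        V (x : ℕ) = m ⬝ᵥ r' + γ * V (min (m ⬝ᵥ g') N) →
        V (x : ℕ) - Φ (x : ℕ) ≤ ρ + γ * ∑ z, p z * (V (z : ℕ) - Φ (z : ℕ))

section Comparison

variable {K : ℕ} {S : Finset (Fin K)} {g r : Fin K → ℝ} {γ : ℝ}

theorem sqrt_le_div_sqrt {N x : ℕ} (hx : 0 < x) (hxN : x ≤ N) : √(N : ℝ) ≤ N / √(x : ℝ) := by
  have h1 : (0 : ℝ) < √(x : ℝ) := Real.sqrt_pos.2 (by exact_mod_cast hx)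
  rw [le_div_iff₀ h1]
  calc √(N : ℝ) * √(x : ℝ) ≤ √(N : ℝ) * √(N : ℝ) := by gcongr
    _ = N := Real.mul_self_sqrt (Nat.cast_nonneg N)

/-- If linear functions of the slopes `β` and `α` satisfy the Bellman inequalities for the true
parameters, then the solution of the estimated Bellman equation is Lipschitz up to a small additive
error, uniformly in the maximal crowd, and the error of one step is uniformly small. -/
theorem exists_comparison_of_slopes (hγ0 : 0 ≤ γ) (hγ1 : γ < 1) {α β : ℝ} (hα : α ≤ 0)
    (hβ : 0 ≤ β) (hβr : ∀ k ∈ S, r k + γ * g k * β ≤ β) {k : Fin K} (hk : k ∈ S)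
    (hαr : α ≤ r k + γ * g k * α) :
    ∃ C, HasUpperComparison S g r γ 1 C ∧ HasLowerComparison S g r γ 1 C := by
  have h1γ : 0 < 1 - γ := by linarith
  set L := β - α with hL
  have hL0 : 0 ≤ L := by linarith
  set b := 1 + L with hb
  -- the error of one step is at most `E`
  have key : ∀ (g' r' : Fin K → ℝ) (ε M : ℝ) (N : ℕ) (V : ℝ → ℝ), 0 ≤ ε → 0 ≤ M →
      (∀ k ∈ S, 0 ≤ g' k) → (∀ k ∈ S, |g k - g' k| ≤ ε) → (∀ k ∈ S, |r k - r' k| ≤ ε) →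
      IsReducedValue S g' r' γ N V → ∀ (x : Fin (N + 1)) (m : Fin K → ℝ) (ρ : ℝ)
      (p : Fin (N + 1) → ℝ), IsStep S g r M x m ρ p →
      |ρ + γ * ∑ z, p z * V (z : ℕ) - (m ⬝ᵥ r' + γ * V (min (m ⬝ᵥ g') N))| ≤
        (b + 2 * b / (1 - γ)) * (N * ε) + 2 * L * (M * √(N : ℝ)) := by
    intro g' r' ε M N V hε hM hg' hgε hrε hV x m ρ p h
    have hN : (0 : ℝ) ≤ N := Nat.cast_nonneg N
    have hxN := (IsStep.cast_mem_Icc x).2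
    have hmod : ∀ {c z : ℝ}, c ∈ Icc (0 : ℝ) N → z ∈ Icc (0 : ℝ) N →
        |V z - V c| ≤ L * |z - c| + b * ε * N / (1 - γ) := by
      intro c z hc hz
      refine hV.abs_sub_le hγ0 hγ1 hN hg' hα hβ (by positivity) (fun j hj => ?_) hk ?_
        (by linarith) (by linarith) hc hz
      · have h1 := abs_le.1 (hgε j hj)
        have h2 := abs_le.1 (hrε j hj)
        have h3 : γ * β * (g' j - g j) ≤ γ * β * ε :=
          mul_le_mul_of_nonneg_left (by linarith) (by positivity)
        have h4 : γ * β * ε ≤ L * ε := by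
          refine mul_le_mul_of_nonneg_right ?_ hε
          have : γ * β ≤ β := mul_le_of_le_one_left hβ hγ1.le
          linarith
        have := hβr j hj
        rw [hb]; linarith
      · have h1 := abs_le.1 (hgε k hk)
        have h2 := abs_le.1 (hrε k hk)
        have h3 : γ * -α * (g' k - g k) ≤ γ * -α * ε :=
          mul_le_mul_of_nonneg_left (by linarith) (mul_nonneg hγ0 (by linarith))
        have h4 : γ * -α * ε ≤ L * ε := by
          refine mul_le_mul_of_nonneg_right ?_ hε
          have : γ * -α ≤ -α := mul_le_of_le_one_left (by linarith) hγ1.le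
          linarith
        rw [hb]; linarith
    have hmean0 : 0 ≤ m ⬝ᵥ g :=
      (Finset.sum_nonneg fun z _ => mul_nonneg (h.nonneg z) (Nat.cast_nonneg _)).trans h.mean
    have hcm : min (m ⬝ᵥ g) (N : ℝ) ∈ Icc (0 : ℝ) N := ⟨le_min hmean0 hN, min_le_right _ _⟩
    have h1 := h.abs_sub_le (g' := g') hγ0 hγ1 hrε V
    have h2 : ∑ z, p z * |V (z : ℕ) - V (min (m ⬝ᵥ g) N)| ≤
        L * (M * √(2 * (x : ℕ))) + b * ε * N / (1 - γ) := by
      calc _ ≤ ∑ z, p z * (L * |((z : ℕ) : ℝ) - min (m ⬝ᵥ g) N| + b * ε * N / (1 - γ)) :=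
            Finset.sum_le_sum fun z _ =>
              mul_le_mul_of_nonneg_left (hmod hcm (IsStep.cast_mem_Icc z)) (h.nonneg z)
        _ = L * ∑ z, p z * |((z : ℕ) : ℝ) - min (m ⬝ᵥ g) N| + b * ε * N / (1 - γ) := by
            simp only [mul_add, Finset.sum_add_distrib, ← Finset.sum_mul, h.sum_eq_one, one_mul,
              mul_left_comm _ L, ← Finset.mul_sum]
        _ ≤ _ := by
            have := mul_le_mul_of_nonneg_left (h.sum_abs_sub_le hM) hL0
            linarith
    have h3 := (hmod hcm (IsReducedValue.next_mem hN hg' h.mem).2).trans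
      (add_le_add_left (mul_le_mul_of_nonneg_left (h.abs_min_sub_min_le hgε) hL0) _)
    have h4 : √(2 * ((x : ℕ) : ℝ)) ≤ 2 * √(N : ℝ) := by
      refine Real.sqrt_le_iff.2 ⟨by positivity, ?_⟩
      rw [mul_pow, Real.sq_sqrt hN]
      linarith
    have h5 : L * (M * √(2 * ((x : ℕ) : ℝ))) ≤ L * (M * (2 * √(N : ℝ))) := by gcongr
    have h6 : b * (ε * (x : ℕ)) ≤ b * (ε * N) := by gcongr
    have h7 : b * (ε * (x : ℕ)) = ε * (x : ℕ) + L * (ε * (x : ℕ)) := by rw [hb]; ring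
    have h8 : (b + 2 * b / (1 - γ)) * (N * ε) + 2 * L * (M * √(N : ℝ)) =
        b * (ε * N) + 2 * (b * ε * N / (1 - γ)) + L * (M * (2 * √(N : ℝ))) := by ring
    rw [h8]
    linarith
  have hbound : ∀ (ε M : ℝ) (N : ℕ), 0 ≤ ε → 0 ≤ M → ∀ x : ℕ, 0 < x → x ≤ N →
      ((b + 2 * b / (1 - γ)) * (N * ε) + 2 * L * (M * √(N : ℝ))) / (1 - γ) ≤
        (b + 2 * b / (1 - γ) + 2 * L) / (1 - γ) * (N * (M / √(x : ℝ) + ε)) := by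
    intro ε M N hε hM x hx hxN
    rw [div_mul_eq_mul_div]
    refine div_le_div_of_nonneg_right ?_ h1γ.le
    have h1 := mul_le_mul_of_nonneg_left (sqrt_le_div_sqrt hx hxN) hM
    have h2 : M * (N / √(x : ℝ)) = N * (M / √(x : ℝ)) := by ring
    have h3 : 0 ≤ b + 2 * b / (1 - γ) := by positivity
    have h4 : 0 ≤ N * (M / √(x : ℝ)) := by positivity
    have h5 : 0 ≤ N * ε := by positivity
    have h6 := mul_le_mul_of_nonneg_left (h1.trans_eq h2) hL0
    have h7 := mul_nonneg h3 h4
    have h8 := mul_nonneg hL0 h5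
    linarith
  refine ⟨(b + 2 * b / (1 - γ) + 2 * L) / (1 - γ), ?_, ?_⟩
  · intro g' r' ε M N V hε _ hM hg' hgε hrε hV
    refine ⟨fun _ => ((b + 2 * b / (1 - γ)) * (N * ε) + 2 * L * (M * √(N : ℝ))) / (1 - γ),
      hbound ε M N hε hM, fun x m ρ p h => ?_⟩
    have h1 := (abs_le.1 (key g' r' ε M N V hε hM hg' hgε hrε hV x m ρ p h)).2
    have h2 := hV.ge _ (IsStep.cast_mem_Icc x) m h.mem
    set E := (b + 2 * b / (1 - γ)) * (N * ε) + 2 * L * (M * √(N : ℝ))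
    have h3 : E / (1 - γ) * (1 - γ) = E := div_mul_cancel₀ _ h1γ.ne'
    simp only [mul_add, Finset.sum_add_distrib, ← Finset.sum_mul, h.sum_eq_one, one_mul]
    linarith
  · intro g' r' ε M N V hε _ hM hg' hgε hrε hV
    refine ⟨fun _ => ((b + 2 * b / (1 - γ)) * (N * ε) + 2 * L * (M * √(N : ℝ))) / (1 - γ),
      hbound ε M N hε hM, fun x m ρ p h hatt => ?_⟩
    have h1 := (abs_le.1 (key g' r' ε M N V hε hM hg' hgε hrε hV x m ρ p h)).1
    set E := (b + 2 * b / (1 - γ)) * (N * ε) + 2 * L * (M * √(N : ℝ))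
    have h3 : E / (1 - γ) * (1 - γ) = E := div_mul_cancel₀ _ h1γ.ne'
    simp only [mul_sub, Finset.sum_sub_distrib, ← Finset.sum_mul, h.sum_eq_one, one_mul]
    linarith

/-- Comparison for a crowd that does not shrink in mean before it reaches `δ * N`, and a value
function whose slopes are at most its value per unit of mass: the fluctuations are compensated by
the crowd potential. -/
theorem exists_correction_of_growth (hγ0 : 0 ≤ γ) (hγ1 : γ < 1) {δ Λ : ℝ} (hδ0 : 0 < δ)
    (hδ1 : δ ≤ 1) (hΛ : 0 ≤ Λ) :
    ∃ C, ∀ (g' r' : Fin K → ℝ) (ε M : ℝ) (N : ℕ) (V : ℝ → ℝ), 0 ≤ ε → 0 ≤ M →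
      (∀ k ∈ S, 0 ≤ g' k) → (∀ k ∈ S, |g k - g' k| ≤ ε) → (∀ k ∈ S, |r k - r' k| ≤ ε) →
      (∀ y ∈ Icc (0 : ℝ) N, |V y| ≤ Λ * N) → V 0 = 0 →
      (∀ c z : ℝ, 0 < c → c ≤ N → z ∈ Icc (0 : ℝ) N → |V z - V c| ≤ |V c| / c * |z - c|) →
      ∃ Φ : ℝ → ℝ, (∀ x : ℕ, 0 < x → x ≤ N → Φ x ≤ C * (N * (M / √x + ε))) ∧
        ∀ (x : Fin (N + 1)) (m : Fin K → ℝ) (ρ : ℝ) (p : Fin (N + 1) → ℝ),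
          IsStep S g r M x m ρ p →
          (0 < (x : ℕ) → min ((x : ℕ) : ℝ) (δ * N) ≤ m ⬝ᵥ g) →
          ρ + γ * ∑ z, p z * (V (z : ℕ) + Φ (z : ℕ)) ≤
            m ⬝ᵥ r' + γ * V (min (m ⬝ᵥ g') N) + Φ (x : ℕ) ∧
          m ⬝ᵥ r' + γ * V (min (m ⬝ᵥ g') N) - Φ (x : ℕ) ≤
            ρ + γ * ∑ z, p z * (V (z : ℕ) - Φ (z : ℕ)) := by
  obtain ⟨A, hA1, hA⟩ := exists_crowdPotential_contraction hγ0 hγ1 hδ0 hδ1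
  have h1γ : 0 < 1 - γ := by linarith
  have hA0 : 0 < A := by linarith
  set b₁ := 4 * (Λ * (2 + √(2 / δ))) / (1 - γ) with hb₁
  set b₂ := (1 + Λ / δ) / (1 - γ) with hb₂
  have hb₁0 : 0 ≤ b₁ := by positivity
  have hb₂0 : 0 ≤ b₂ := by positivity
  have hb₁γ : (1 - γ) * b₁ = 4 * (Λ * (2 + √(2 / δ))) := mul_div_cancel₀ _ h1γ.ne'
  have hb₂γ : (1 - γ) * b₂ = 1 + Λ / δ := mul_div_cancel₀ _ h1γ.ne'
  refine ⟨b₁ * (A / √δ) + b₂, ?_⟩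
  intro g' r' ε M N V hε hM hg' hgε hrε hVΛ hV0 hmod
  have hN : (0 : ℝ) ≤ N := Nat.cast_nonneg N
  have hAM : 0 ≤ A * M := mul_nonneg hA0.le hM
  refine ⟨fun y => N * (b₁ * crowdPotential (A * M) (δ * N) y + b₂ * ε), fun x hx hxN => ?_,
    fun x m ρ p h hgrow => ?_⟩
  · have hx0 : (0 : ℝ) < x := by exact_mod_cast hx
    have hxN' : (x : ℝ) ≤ N := by exact_mod_cast hxN
    have h1 : √δ * √(x : ℝ) ≤ √(min (x : ℝ) (δ * N)) := by
      rw [← Real.sqrt_mul hδ0.le]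
      exact Real.sqrt_le_sqrt (le_min (mul_le_of_le_one_left hx0.le hδ1)
        (mul_le_mul_of_nonneg_left hxN' hδ0.le))
    have h2 : crowdPotential (A * M) (δ * N) x ≤ A * M / (√δ * √(x : ℝ)) :=
      (min_le_right _ _).trans (div_le_div_of_nonneg_left hAM (by positivity) h1)
    have h3 : A * M / (√δ * √(x : ℝ)) = A / √δ * (M / √(x : ℝ)) := by
      rw [mul_div_mul_comm]
    rw [h3] at h2
    have h4 := mul_le_mul_of_nonneg_left h2 hb₁0
    have h5 : 0 ≤ b₁ * (A / √δ) * ε := by positivity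
    have h6 : 0 ≤ b₂ * (M / √(x : ℝ)) := by positivity
    have h7 : b₁ * crowdPotential (A * M) (δ * N) x + b₂ * ε ≤
        (b₁ * (A / √δ) + b₂) * (M / √(x : ℝ) + ε) := by linarith
    have := mul_le_mul_of_nonneg_left h7 hN
    linarith
  rcases Nat.eq_zero_or_pos (x : ℕ) with hx | hx
  · have hm := h.mem
    rw [hx, Nat.cast_zero] at hm
    have hm0 : m = 0 := eq_zero_of_mem_allocations_zero hm
    have h1 : 0 ≤ N * (b₁ * crowdPotential (A * M) (δ * N) 0 + b₂ * ε) :=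
      mul_nonneg hN (add_nonneg (mul_nonneg hb₁0 (crowdPotential_nonneg hAM))
        (mul_nonneg hb₂0 hε))
    have h2 := h.of_zero hx fun y =>
      V y + N * (b₁ * crowdPotential (A * M) (δ * N) y + b₂ * ε)
    have h3 := h.of_zero hx fun y =>
      V y - N * (b₁ * crowdPotential (A * M) (δ * N) y + b₂ * ε)
    have h4 := mul_le_of_le_one_left h1 hγ1.le
    simp only at h2 h3 ⊢
    rw [h2.2, h3.2, h2.1, hm0, zero_dotProduct, zero_dotProduct, min_eq_left hN, hx,
      Nat.cast_zero, hV0]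
    constructor <;> linarith
  have hx0 : (0 : ℝ) < (x : ℕ) := by exact_mod_cast hx
  have hxN : ((x : ℕ) : ℝ) ≤ N := (IsStep.cast_mem_Icc x).2
  have hN0 : (0 : ℝ) < N := hx0.trans_le hxN
  have hμg := hgrow hx
  have hcontr := hA M N x p (min (m ⬝ᵥ g) N) hM hx h.nonneg h.sum_eq_one h.second
    (le_min hμg ((min_le_left _ _).trans hxN))
  have hφ0 : 0 ≤ crowdPotential (A * M) (δ * N) (x : ℕ) := crowdPotential_nonneg hAM
  have hstep : |ρ + γ * ∑ z, p z * V (z : ℕ) - (m ⬝ᵥ r' + γ * V (min (m ⬝ᵥ g') N))| ≤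
      (1 - γ) * N * (b₁ / 4 * crowdPotential (A * M) (δ * N) (x : ℕ) + b₂ * ε) := by
    refine (h.abs_sub_le (g' := g') hγ0 hγ1 hrε V).trans ?_
    have hdiff := h.abs_min_sub_min_le hgε
    have hfluct := h.sum_abs_sub_le hM
    have hc' := (IsReducedValue.next_mem hN hg' h.mem).2
    have hμc : min ((x : ℕ) : ℝ) (δ * N) ≤ min (m ⬝ᵥ g) N :=
      le_min hμg ((min_le_left _ _).trans hxN)
    have hcN : min (m ⬝ᵥ g) (N : ℝ) ≤ N := min_le_right _ _
    have hxμ : δ * (x : ℕ) ≤ min ((x : ℕ) : ℝ) (δ * N) :=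
      le_min (mul_le_of_le_one_left hx0.le hδ1) (mul_le_mul_of_nonneg_left hxN hδ0.le)
    set μ := min ((x : ℕ) : ℝ) (δ * N) with hμ
    have hμ0 : 0 < μ := lt_min hx0 (mul_pos hδ0 hN0)
    set c := min (m ⬝ᵥ g) (N : ℝ) with hc
    have hc0 : 0 < c := hμ0.trans_le hμc
    have hslope : |V c| / c ≤ Λ * N / μ :=
      div_le_div₀ (by positivity) (hVΛ c ⟨hc0.le, hcN⟩) hμ0 hμc
    have hslope0 : 0 ≤ Λ * N / μ := by positivity
    have h1 : |V (min (m ⬝ᵥ g') N) - V c| ≤ Λ / δ * (N * ε) := by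
      refine (hmod c _ hc0 hcN hc').trans ((mul_le_mul hslope hdiff (abs_nonneg _) hslope0).trans ?_)
      have h2 : (x : ℕ) / μ ≤ 1 / δ := by
        rw [div_le_div_iff₀ hμ0 hδ0]; linarith
      calc Λ * N / μ * (ε * (x : ℕ)) = Λ * N * ε * ((x : ℕ) / μ) := by ring
        _ ≤ Λ * N * ε * (1 / δ) := by gcongr
        _ = Λ / δ * (N * ε) := by ring
    have h2 : ∑ z, p z * |V (z : ℕ) - V c| ≤
        Λ * (2 + √(2 / δ)) * N * crowdPotential (A * M) (δ * N) (x : ℕ) := by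
      rcases le_total 1 (A * M / √μ) with hs | hs
      · have hφ : crowdPotential (A * M) (δ * N) (x : ℕ) = 1 := min_eq_left hs
        rw [hφ, mul_one]
        have h3 : ∑ z, p z * |V (z : ℕ) - V c| ≤ 2 * (Λ * N) := by
          refine h.sum_le fun z => (abs_sub _ _).trans ?_
          have h4 := hVΛ _ (IsStep.cast_mem_Icc z)
          have h5 := hVΛ c ⟨hc0.le, hcN⟩
          linarith
        have h4 : 0 ≤ Λ * √(2 / δ) * N := by positivity
        linarith
      · have hφ : crowdPotential (A * M) (δ * N) (x : ℕ) = A * M / √μ := min_eq_right hs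
        rw [hφ]
        have hsμ : 0 < √μ := Real.sqrt_pos.2 hμ0
        have h3 : √(2 * ((x : ℕ) : ℝ)) ≤ √(2 / δ) * √μ := by
          rw [← Real.sqrt_mul (by positivity)]
          refine Real.sqrt_le_sqrt ?_
          rw [div_mul_eq_mul_div, le_div_iff₀ hδ0]
          linarith
        calc ∑ z, p z * |V (z : ℕ) - V c|
            ≤ ∑ z, p z * (Λ * N / μ * |((z : ℕ) : ℝ) - c|) := by
              refine Finset.sum_le_sum fun z _ => mul_le_mul_of_nonneg_left ?_ (h.nonneg z)
              exact (hmod c _ hc0 hcN (IsStep.cast_mem_Icc z)).trans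
                (mul_le_mul_of_nonneg_right hslope (abs_nonneg _))
          _ = Λ * N / μ * ∑ z, p z * |((z : ℕ) : ℝ) - c| := by
              simp only [mul_left_comm _ (Λ * N / μ), ← Finset.mul_sum]
          _ ≤ Λ * N / μ * (M * (√(2 / δ) * √μ)) := by
              refine mul_le_mul_of_nonneg_left (hfluct.trans ?_) hslope0
              exact mul_le_mul_of_nonneg_left h3 hM
          _ = Λ * N * √(2 / δ) * (M / √μ) := by
              have : μ = √μ * √μ := (Real.mul_self_sqrt hμ0.le).symm
              rw [div_mul_eq_mul_div, div_eq_iff hμ0.ne']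
              nth_rewrite 3 [this]
              field_simp
          _ ≤ Λ * (2 + √(2 / δ)) * N * (A * M / √μ) := by
              have h4 : Λ * N * √(2 / δ) ≤ Λ * (2 + √(2 / δ)) * N := by
                have : 0 ≤ Λ * N := by positivity
                linarith
              have h5 : M / √μ ≤ A * M / √μ :=
                div_le_div_of_nonneg_right (le_mul_of_one_le_left hM hA1) hsμ.le
              gcongr
    have h3 : ε * (x : ℕ) ≤ ε * N := by gcongr
    have h4 : (1 - γ) * N * (b₁ / 4 * crowdPotential (A * M) (δ * N) (x : ℕ) + b₂ * ε) =
        ((1 - γ) * b₁) / 4 * N * crowdPotential (A * M) (δ * N) (x : ℕ) +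
          ((1 - γ) * b₂) * (N * ε) := by ring
    rw [h4, hb₁γ, hb₂γ]
    linarith
  have hstep' := abs_le.1 hstep
  set φ := fun y => crowdPotential (A * M) (δ * N) y with hφ
  have hsumΦ : ∑ z, p z * (N * (b₁ * φ (z : ℕ) + b₂ * ε)) =
      N * (b₁ * ∑ z, p z * φ (z : ℕ) + b₂ * ε) := by
    have : ∀ z : Fin (N + 1), p z * (N * (b₁ * φ (z : ℕ) + b₂ * ε)) =
        N * (b₁ * (p z * φ (z : ℕ))) + p z * (N * (b₂ * ε)) := fun z => by ring
    simp only [this, Finset.sum_add_distrib, ← Finset.mul_sum, ← Finset.sum_mul, h.sum_eq_one]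
    ring
  have hdecr : γ * (N * (b₁ * ∑ z, p z * φ (z : ℕ) + b₂ * ε)) ≤
      N * (b₁ * φ (x : ℕ) + b₂ * ε) - (1 - γ) * N * (b₁ / 4 * φ (x : ℕ) + b₂ * ε) := by
    have := mul_le_mul_of_nonneg_left hcontr (mul_nonneg hN hb₁0)
    linarith
  constructor
  · change ρ + γ * ∑ z, p z * (V (z : ℕ) + N * (b₁ * φ (z : ℕ) + b₂ * ε)) ≤
      _ + N * (b₁ * φ (x : ℕ) + b₂ * ε)
    simp only [mul_add (p _) (V _), Finset.sum_add_distrib]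
    rw [hsumΦ, mul_add]
    linarith
  · change _ - N * (b₁ * φ (x : ℕ) + b₂ * ε) ≤
      ρ + γ * ∑ z, p z * (V (z : ℕ) - N * (b₁ * φ (z : ℕ) + b₂ * ε))
    simp only [mul_sub (p _) (V _), Finset.sum_sub_distrib]
    rw [hsumΦ, mul_sub]
    linarith

end Comparison

/-! ### The comparison for a set of arms -/

section Comparison

variable {K : ℕ} {S : Finset (Fin K)} {g r : Fin K → ℝ} {γ : ℝ}

theorem HasUpperComparison.mono {ε₀ ε₁ C C' : ℝ} (h : HasUpperComparison S g r γ ε₀ C)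
    (hε : ε₁ ≤ ε₀) (hC : C ≤ C') : HasUpperComparison S g r γ ε₁ C' := by
  intro g' r' ε M N V h0 h1 hM hg' hgε hrε hV
  obtain ⟨Φ, h2, h3⟩ := h g' r' ε M N V h0 (h1.trans hε) hM hg' hgε hrε hV
  exact ⟨Φ, fun x hx hxN => (h2 x hx hxN).trans (mul_le_mul_of_nonneg_right hC (by positivity)), h3⟩

theorem HasLowerComparison.mono {ε₀ ε₁ C C' : ℝ} (h : HasLowerComparison S g r γ ε₀ C)
    (hε : ε₁ ≤ ε₀) (hC : C ≤ C') : HasLowerComparison S g r γ ε₁ C' := by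
  intro g' r' ε M N V h0 h1 hM hg' hgε hrε hV
  obtain ⟨Φ, h2, h3⟩ := h g' r' ε M N V h0 (h1.trans hε) hM hg' hgε hrε hV
  exact ⟨Φ, fun x hx hxN => (h2 x hx hxN).trans (mul_le_mul_of_nonneg_right hC (by positivity)), h3⟩

theorem exists_pos_le_of_forall_pos {ι : Type*} (S : Finset ι) {f : ι → ℝ}
    (hf : ∀ k ∈ S, 0 < f k) : ∃ ε : ℝ, 0 < ε ∧ ε ≤ 1 ∧ ∀ k ∈ S, ε ≤ f k := by
  rcases S.eq_empty_or_nonempty with h | h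
  · exact ⟨1, one_pos, le_rfl, by simp [h]⟩
  · obtain ⟨k, hk, hmin⟩ := S.exists_min_image f h
    exact ⟨min 1 (f k), lt_min one_pos (hf k hk), min_le_left _ _,
      fun j hj => (min_le_right _ _).trans (hmin j hj)⟩

theorem abs_le_sum_abs_add_one {r' : Fin K → ℝ} {ε : ℝ} (hε : ε ≤ 1) {k : Fin K}
    (h : |r k - r' k| ≤ ε) : |r' k| ≤ ∑ j, |r j| + 1 := by
  have h1 := Finset.single_le_sum (f := fun j => |r j|) (fun _ _ => abs_nonneg _)
    (Finset.mem_univ k)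
  have h2 := abs_sub_abs_le_abs_sub (r' k) (r k)
  rw [abs_sub_comm] at h2
  linarith

/-- If all rewards are negative and all growths are at least `1`, then the crowd grows under every
policy. -/
theorem exists_comparison_of_negative (hγ0 : 0 ≤ γ) (hγ1 : γ < 1) (hr : ∀ k ∈ S, r k < 0)
    (hg : ∀ k ∈ S, 1 ≤ g k) :
    ∃ ε₀ C, 0 < ε₀ ∧ HasUpperComparison S g r γ ε₀ C ∧ HasLowerComparison S g r γ ε₀ C := by
  have h1γ : 0 < 1 - γ := by linarith
  obtain ⟨ε₀, hε₀, hε₀1, hε₀r⟩ := exists_pos_le_of_forall_pos S (f := fun k => -r k)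
    fun k hk => neg_pos.2 (hr k hk)
  set R := ∑ j, |r j| + 1 with hR
  have hR0 : 0 ≤ R := by positivity
  obtain ⟨C, hC⟩ := exists_correction_of_growth (S := S) (g := g) (r := r) hγ0 hγ1 one_pos le_rfl
    (Λ := R / (1 - γ)) (by positivity)
  have key : ∀ (g' r' : Fin K → ℝ) (ε M : ℝ) (N : ℕ) (V : ℝ → ℝ), 0 ≤ ε → ε ≤ ε₀ → 0 ≤ M →
      (∀ k ∈ S, 0 ≤ g' k) → (∀ k ∈ S, |g k - g' k| ≤ ε) → (∀ k ∈ S, |r k - r' k| ≤ ε) →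
      IsReducedValue S g' r' γ N V → _ :=
    fun g' r' ε M N V hε hεε₀ hM hg' hgε hrε hV => hC g' r' ε M N V hε hM hg' hgε hrε (by
      have hN : (0 : ℝ) ≤ N := Nat.cast_nonneg N
      intro y hy
      refine (hV.abs_le hγ0 hγ1 hN hg' hR0
        (fun k hk => abs_le_sum_abs_add_one (hεε₀.trans hε₀1) (hrε k hk)) y hy).trans_eq ?_
      ring) (hV.zero hγ1 (Nat.cast_nonneg N)) (by
      have hN : (0 : ℝ) ≤ N := Nat.cast_nonneg N
      have hr' : ∀ k ∈ S, r' k ≤ 0 := fun k hk => by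
        have h1 := abs_le.1 (hrε k hk)
        have h2 := hε₀r k hk
        linarith
      intro c z hc hcN hz
      have h1 := abs_sub_le_of_starShaped (U := fun y => -V y)
        (hV.antitoneOn hγ0 hγ1 hN hg' hr').neg (fun {y z} hy hyz hz => by
          have := hV.mul_le_mul_of_nonpos_reward hγ0 hγ1 hN hg' hr' hy hyz hz
          simp only [mul_neg]; linarith) hc hcN hz
      simp only [neg_sub_neg] at h1
      rw [abs_sub_comm] at h1
      refine h1.trans (mul_le_mul_of_nonneg_right ?_ (abs_nonneg _))
      exact div_le_div_of_nonneg_right (neg_le_abs _) hc.le)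
  have hgrow : ∀ {M : ℝ} {N : ℕ} {x : Fin (N + 1)} {m : Fin K → ℝ} {ρ : ℝ}
      {p : Fin (N + 1) → ℝ}, IsStep S g r M x m ρ p → 0 < (x : ℕ) →
      min ((x : ℕ) : ℝ) (1 * N) ≤ m ⬝ᵥ g := by
    intro M N x m ρ p h _
    have := le_dotProduct_of_mem_allocations h.mem hg
    rw [one_mul] at this
    exact (min_le_left _ _).trans this
  refine ⟨ε₀, C, hε₀, ?_, ?_⟩
  · intro g' r' ε M N V hε hεε₀ hM hg' hgε hrε hV
    obtain ⟨Φ, h1, h2⟩ := key g' r' ε M N V hε hεε₀ hM hg' hgε hrε hV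
    refine ⟨Φ, h1, fun x m ρ p h => ?_⟩
    have h3 := (h2 x m ρ p h (hgrow h)).1
    have h4 := hV.ge _ (IsStep.cast_mem_Icc x) m h.mem
    linarith
  · intro g' r' ε M N V hε hεε₀ hM hg' hgε hrε hV
    obtain ⟨Φ, h1, h2⟩ := key g' r' ε M N V hε hεε₀ hM hg' hgε hrε hV
    refine ⟨Φ, h1, fun x m ρ p h hatt => ?_⟩
    rw [hatt]
    exact (h2 x m ρ p h (hgrow h)).2

/-- If no linear function is a supersolution of the Bellman equation, then some arm makes the crowd
grow. -/
theorem exists_one_lt_growth (hγ0 : 0 ≤ γ) (hγ1 : γ < 1)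
    (himp : ∀ β : ℝ, 0 ≤ β → ∃ k ∈ S, β < r k + γ * g k * β) : ∃ k ∈ S, 0 < γ ∧ 1 < g k := by
  have h : ∃ k ∈ S, 1 ≤ γ * g k := by
    by_contra! hcon
    have hnn : ∀ k ∈ S, 0 ≤ |r k| / (1 - γ * g k) := fun k hk =>
      div_nonneg (abs_nonneg _) (by linarith [hcon k hk])
    obtain ⟨k, hk, hlt⟩ := himp (∑ k ∈ S, |r k| / (1 - γ * g k)) (Finset.sum_nonneg hnn)
    have h1 := Finset.single_le_sum hnn hk
    have h2 : 0 < 1 - γ * g k := by linarith [hcon k hk]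
    rw [div_le_iff₀ h2] at h1
    linarith [le_abs_self (r k)]
  obtain ⟨k, hk, h1⟩ := h
  have hγ : 0 < γ := hγ0.lt_of_ne fun h => by rw [← h] at h1; linarith
  refine ⟨k, hk, hγ, ?_⟩
  by_contra! h2
  have := mul_le_mul_of_nonneg_left h2 hγ0
  linarith

/-- If no linear function is a supersolution of the Bellman equation, then the improvement in one
step is bounded below for bounded slopes. -/
theorem exists_uniform_improvement
    (himp : ∀ β : ℝ, 0 ≤ β → ∃ k ∈ S, β < r k + γ * g k * β) (P : ℝ) :
    ∃ f : ℝ, 0 < f ∧ f ≤ 1 ∧ ∀ p, 0 ≤ p → p ≤ P → ∃ k ∈ S, p + 2 * f ≤ r k + γ * g k * p := by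
  rcases lt_or_ge P 0 with hP | hP
  · exact ⟨1, one_pos, le_rfl, fun p h0 h1 => absurd (h0.trans h1) (not_le.2 hP)⟩
  have hS : S.Nonempty := let ⟨k, hk, _⟩ := himp 0 le_rfl; ⟨k, hk⟩
  have hcont : Continuous fun p : ℝ => S.sup' hS (fun k => r k + γ * g k * p) - p := by
    refine Continuous.sub ?_ continuous_id
    exact Continuous.finset_sup'_apply hS fun k _ => by fun_prop
  obtain ⟨q, hq, hmin⟩ := isCompact_Icc.exists_isMinOn ⟨0, left_mem_Icc.2 hP⟩ hcont.continuousOn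
  have hpos : 0 < S.sup' hS (fun k => r k + γ * g k * q) - q := by
    obtain ⟨k, hk, hlt⟩ := himp q hq.1
    have := Finset.le_sup' (fun k => r k + γ * g k * q) hk
    linarith
  set f := S.sup' hS (fun k => r k + γ * g k * q) - q with hf
  refine ⟨min 1 (f / 2), lt_min one_pos (by linarith), min_le_left _ _, fun p h0 h1 => ?_⟩
  have h2 := isMinOn_iff.1 hmin p ⟨h0, h1⟩
  obtain ⟨k, hk, hk'⟩ := S.exists_mem_eq_sup' hS fun k => r k + γ * g k * p
  refine ⟨k, hk, ?_⟩
  rw [hk'] at h2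
  have := min_le_right 1 (f / 2)
  linarith

/-- The expected value of the next crowd is at most the value of its mean. -/
theorem IsStep.sum_mul_le_of_concaveOn {M : ℝ} {N : ℕ} {x : Fin (N + 1)} {m : Fin K → ℝ} {ρ : ℝ}
    {p : Fin (N + 1) → ℝ} (h : IsStep S g r M x m ρ p) {V : ℝ → ℝ}
    (hV : ConcaveOn ℝ (Icc (0 : ℝ) N) V) (hmono : MonotoneOn V (Icc (0 : ℝ) N)) :
    ∑ z, p z * V (z : ℕ) ≤ V (min (m ⬝ᵥ g) N) := by
  have h1 := hV.le_map_sum (t := Finset.univ) (w := p) (p := fun z : Fin (N + 1) => ((z : ℕ) : ℝ))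
    (fun z _ => h.nonneg z) h.sum_eq_one fun z _ => IsStep.cast_mem_Icc z
  simp only [smul_eq_mul] at h1
  have h2 : ∑ z, p z * ((z : ℕ) : ℝ) ≤ N := h.sum_le fun z => (IsStep.cast_mem_Icc z).2
  have h0 : 0 ≤ ∑ z, p z * ((z : ℕ) : ℝ) :=
    Finset.sum_nonneg fun z _ => mul_nonneg (h.nonneg z) (Nat.cast_nonneg _)
  exact h1.trans (hmono ⟨h0, h2⟩ ⟨h0.trans (le_min h.mean h2), min_le_right _ _⟩
    (le_min h.mean h2))

/-- If some reward is positive and no linear function is a supersolution of the Bellman equation,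
then the upper comparison holds because the value function is concave, and the lower comparison
because it is so steep at small crowds that optimal actions make small crowds grow. -/
theorem exists_comparison_of_improvable (hγ0 : 0 ≤ γ) (hγ1 : γ < 1)
    (himp : ∀ β : ℝ, 0 ≤ β → ∃ k ∈ S, β < r k + γ * g k * β) :
    ∃ ε₀ C C', 0 < ε₀ ∧ HasUpperComparison S g r γ ε₀ C ∧ HasLowerComparison S g r γ ε₀ C' := by
  have h1γ : 0 < 1 - γ := by linarith
  obtain ⟨k₀, hk₀, hγpos, hgk₀⟩ := exists_one_lt_growth hγ0 hγ1 himp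
  obtain ⟨k₁, hk₁, hrk₁⟩ := himp 0 le_rfl
  rw [mul_zero, add_zero] at hrk₁
  set c := (g k₀ - 1) / 4 with hc_def
  have hc : 0 < c := by linarith
  set R := ∑ j, |r j| + 1 with hR_def
  have hR0 : 0 ≤ R := by positivity
  -- beyond this slope, moving mass to the growing arm `k₀` is an improvement
  set L := (2 * R + 1) / (γ * c) with hL_def
  have hLR : 2 * R < γ * L * c := by
    have : γ * L * c = 2 * R + 1 := by rw [hL_def]; field_simp
    linarith
  have hL0 : 0 ≤ L := by positivity
  obtain ⟨f, hf0, hf1, hf⟩ := exists_uniform_improvement himp (L + 1)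
  set T := ⌈L / f⌉₊ with hT_def
  have hTL : L ≤ T * f := (div_le_iff₀ hf0).1 (Nat.le_ceil _)
  have hTP : T * f ≤ L + 1 := by
    have h1 := (Nat.ceil_lt_add_one (div_nonneg hL0 hf0.le)).le
    have h2 := mul_le_mul_of_nonneg_right h1 hf0.le
    rw [add_mul, div_mul_cancel₀ _ hf0.ne'] at h2
    linarith
  set G := ∑ k, |g k| + 1 with hG_def
  have hG1 : 1 ≤ G := by
    have : 0 ≤ ∑ k, |g k| := Finset.sum_nonneg fun _ _ => abs_nonneg _
    linarith
  have hGT : 1 ≤ G ^ T := one_le_pow₀ hG1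
  set δ := 1 / G ^ T with hδ_def
  have hδ0 : 0 < δ := by positivity
  have hδ1 : δ ≤ 1 := by rw [hδ_def]; exact (div_le_one (by positivity)).2 hGT
  obtain ⟨ε₀, hε₀, hε₀1, hεc, hεr, hεf, hεδ⟩ : ∃ ε₀ : ℝ, 0 < ε₀ ∧ ε₀ ≤ 1 ∧ ε₀ ≤ c ∧ ε₀ ≤ r k₁ ∧
      ε₀ * (L + 2) ≤ f ∧ ε₀ ≤ δ / 2 := by
    refine ⟨min (min 1 c) (min (r k₁) (min (f / (L + 2)) (δ / 2))), ?_, ?_, ?_, ?_, ?_, ?_⟩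
    · have : 0 < f / (L + 2) := by positivity
      simp only [lt_min_iff]
      exact ⟨⟨one_pos, hc⟩, hrk₁, this, by linarith⟩
    · exact (min_le_left _ _).trans (min_le_left _ _)
    · exact (min_le_left _ _).trans (min_le_right _ _)
    · exact (min_le_right _ _).trans (min_le_left _ _)
    · exact (le_div_iff₀ (by linarith)).1
        ((min_le_right _ _).trans ((min_le_right _ _).trans (min_le_left _ _)))
    · exact (min_le_right _ _).trans ((min_le_right _ _).trans (min_le_right _ _))
  obtain ⟨C', hC'⟩ := exists_correction_of_growth (S := S) (g := g) (r := r) hγ0 hγ1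
    (δ := δ / 2) (Λ := R / (1 - γ)) (by linarith) (by linarith) (by positivity)
  set C := (1 + (2 * R / c + R / (1 - γ))) / (1 - γ) with hC_def
  have hC0 : 0 ≤ C := by positivity
  refine ⟨ε₀, C, C', hε₀, ?_, ?_⟩
  all_goals
    intro g' r' ε M N V hε hεε₀ hM hg' hgε hrε hV
    have hN : (0 : ℝ) ≤ N := Nat.cast_nonneg N
    have hgk₀' : 1 + 2 * c ≤ g' k₀ := by linarith [(abs_le.1 (hgε k₀ hk₀)).2]
    have hrk₁' : 0 ≤ r' k₁ := by linarith [(abs_le.1 (hrε k₁ hk₁)).2]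
    have hR' : ∀ k ∈ S, |r' k| ≤ R := fun k hk =>
      abs_le_sum_abs_add_one (hεε₀.trans hε₀1) (hrε k hk)
    have hmono := hV.monotoneOn hγ0 hγ1 hN hg' hk₁ hrk₁'
  · refine ⟨fun _ => C * (N * ε), fun x hx hxN => ?_, fun x m ρ p h => ?_⟩
    · have : 0 ≤ M / √(x : ℝ) := by positivity
      change C * (N * ε) ≤ C * (N * (M / √(x : ℝ) + ε))
      gcongr
      linarith
    · have h1 := h.sum_mul_le_of_concaveOn (hV.concaveOn hγ0 hγ1 hN hg' hk₁ hrk₁') hmono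
      have hmean0 : 0 ≤ m ⬝ᵥ g :=
        (Finset.sum_nonneg fun z _ => mul_nonneg (h.nonneg z) (Nat.cast_nonneg _)).trans h.mean
      have h2 := abs_le.1 (abs_dotProduct_sub_le_of_mem_allocations h.mem hgε)
      have h3 := abs_le.1 (abs_dotProduct_sub_le_of_mem_allocations h.mem hrε)
      have h4 := hV.reward_add_le_of_growth_le hγ0 hγ1 hN hg' hc hk₀ hgk₀' hR' hε
        (hεε₀.trans hεc) hk₁ hrk₁' (IsStep.cast_mem_Icc x) h.mem hmean0 (by linarith)
      have h5 : ε * (x : ℕ) ≤ ε * N :=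
        mul_le_mul_of_nonneg_left (IsStep.cast_mem_Icc x).2 hε
      have h6 := mul_le_mul_of_nonneg_left h1 hγ0
      have h7 : C * (N * ε) * (1 - γ) = (1 + (2 * R / c + R / (1 - γ))) * (N * ε) := by
        rw [mul_right_comm, hC_def, div_mul_cancel₀ _ h1γ.ne']
      simp only [mul_add, Finset.sum_add_distrib, ← Finset.sum_mul, h.sum_eq_one, one_mul]
      rw [h.reward]
      linarith
  · obtain ⟨Φ, hΦ, hstep⟩ := hC' g' r' ε M N V hε hM hg' hgε hrε (fun y hy =>
      (hV.abs_le hγ0 hγ1 hN hg' hR0 hR' y hy).trans_eq (by ring)) (hV.zero hγ1 hN)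
      (fun a z ha haN hz => by
        have h1 := abs_sub_le_of_starShaped hmono
          (hV.mul_le_mul_of_nonneg_reward hγ0 hγ1 hN hg' hk₁ hrk₁') ha haN hz
        exact h1.trans (mul_le_mul_of_nonneg_right
          (div_le_div_of_nonneg_right (le_abs_self _) ha.le) (abs_nonneg _)))
    refine ⟨Φ, hΦ, fun x m ρ p h hatt => ?_⟩
    rw [hatt]
    refine (hstep x m ρ p h fun _ => ?_).2
    have hG : ∀ k ∈ S, g' k ≤ G := fun k hk => by
      have h1 := Finset.single_le_sum (f := fun j => |g j|) (fun _ _ => abs_nonneg _)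
        (Finset.mem_univ k)
      have h2 := (abs_le.1 (hgε k hk)).1
      have h3 := le_abs_self (g k)
      linarith
    have hf' : ∀ p, 0 ≤ p → p ≤ L + 1 → ∃ k ∈ S, p + f ≤ r' k + γ * g' k * p := by
      intro p hp0 hpL
      obtain ⟨k, hk, hkp⟩ := hf p hp0 hpL
      refine ⟨k, hk, ?_⟩
      have h1 := (abs_le.1 (hgε k hk)).2
      have h2 := (abs_le.1 (hrε k hk)).2
      have h3 : γ * p * (g k - g' k) ≤ γ * p * ε :=
        mul_le_mul_of_nonneg_left h1 (mul_nonneg hγ0 hp0)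
      have h4 : γ * p * ε ≤ (L + 1) * ε := by
        refine mul_le_mul_of_nonneg_right ?_ hε
        exact (mul_le_of_le_one_left hp0 hγ1.le).trans hpL
      have h5 : ε * (L + 2) ≤ ε₀ * (L + 2) := mul_le_mul_of_nonneg_right hεε₀ (by linarith)
      linarith
    have hslope : ∀ w h : ℝ, 0 ≤ w → 0 ≤ h → w + h ≤ δ * N → h * L ≤ V (w + h) - V w := by
      intro w h hw hh hwh
      have h1 : (w + h) * G ^ T ≤ N := by
        have h2 := mul_le_mul_of_nonneg_right hwh (zero_le_one.trans hGT)
        have h3 : δ * N * G ^ T = N := by rw [hδ_def]; field_simp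
        linarith
      exact (mul_le_mul_of_nonneg_left hTL hh).trans
        (hV.mul_le_sub_of_improvable hγ0 hN hg' hG1 hG hmono hf0.le hf' T hTP hw hh h1)
    have h1 := hV.min_le_growth_of_attained hγ0 hN hg' hδ1 hc hk₀ hgk₀' hR' hLR hslope
      (IsStep.cast_mem_Icc x) h.mem hatt
    have h2 := (abs_le.1 (abs_dotProduct_sub_le_of_mem_allocations h.mem hgε)).1
    have hx := IsStep.cast_mem_Icc x
    have h3 : ε * (x : ℕ) ≤ c * (x : ℕ) := mul_le_mul_of_nonneg_right (hεε₀.trans hεc) hx.1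
    have h4 : ε * (x : ℕ) ≤ δ / 2 * N :=
      mul_le_mul (hεε₀.trans hεδ) hx.2 hx.1 (by linarith)
    rcases min_le_iff.1 h1 with h5 | h5
    · exact (min_le_left _ _).trans (by linarith)
    · exact (min_le_right _ _).trans (by linarith)

/-- Both comparisons hold for every set of arms, with constants that depend only on the true
parameters of these arms. -/
theorem exists_comparison (hγ0 : 0 ≤ γ) (hγ1 : γ < 1) (S : Finset (Fin K)) (g r : Fin K → ℝ)
    (hg : ∀ k, 0 ≤ g k) :
    ∃ ε₀ C, 0 < ε₀ ∧ HasUpperComparison S g r γ ε₀ C ∧ HasLowerComparison S g r γ ε₀ C := by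
  by_cases hpos : ∃ k ∈ S, 0 ≤ r k
  · obtain ⟨k, hk, hrk⟩ := hpos
    by_cases hlin : ∃ β : ℝ, 0 ≤ β ∧ ∀ k ∈ S, r k + γ * g k * β ≤ β
    · obtain ⟨β, hβ, hβr⟩ := hlin
      obtain ⟨C, h1, h2⟩ := exists_comparison_of_slopes hγ0 hγ1 le_rfl hβ hβr hk (by simpa using hrk)
      exact ⟨1, C, one_pos, h1, h2⟩
    · push Not at hlin
      obtain ⟨ε₀, C, C', h0, h1, h2⟩ := exists_comparison_of_improvable hγ0 hγ1 hlin
      exact ⟨ε₀, max C C', h0, h1.mono le_rfl (le_max_left _ _), h2.mono le_rfl (le_max_right _ _)⟩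
  · push Not at hpos
    by_cases hlin : ∃ k ∈ S, γ * g k < 1
    · obtain ⟨k, hk, hgk⟩ := hlin
      have h1 : 0 < 1 - γ * g k := by linarith
      have h2 : r k / (1 - γ * g k) * (1 - γ * g k) = r k := div_mul_cancel₀ _ h1.ne'
      obtain ⟨C, h3, h4⟩ := exists_comparison_of_slopes (S := S) (g := g) (r := r) hγ0 hγ1
        (α := r k / (1 - γ * g k)) (div_nonpos_of_nonpos_of_nonneg (hpos k hk).le h1.le) le_rfl
        (fun j hj => by simpa using (hpos j hj).le) hk (by linarith)
      exact ⟨1, C, one_pos, h3, h4⟩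
    · push Not at hlin
      refine exists_comparison_of_negative hγ0 hγ1 hpos fun k hk => ?_
      exact (hlin k hk).trans (mul_le_of_le_one_left (hg k) hγ1.le)

end Comparison

/-! ### The comparison of the values -/

namespace CrowdBandit

variable {K : ℕ} {γ : ℝ}

/-- The comparison of the Populated MDP with the estimated reduced MDP, for policies that play only
the arms in `S`. -/
theorem exists_abs_optValue_sub_value_le (hγ0 : 0 ≤ γ) (hγ1 : γ < 1) (S : Finset (Fin K))
    (g r : Fin K → ℝ) (hg : ∀ k, 0 ≤ g k) :
    ∃ C : ℝ, 0 ≤ C ∧ ∀ B : CrowdBandit K, B.meanGrowth = g → B.meanReward = r →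
      ∀ (N : ℕ) (x : Fin (N + 1)), 0 < (x : ℕ) → ∀ g' r' : Fin K → ℝ, (∀ k, 0 ≤ g' k) →
      ∀ π : ℝ → ℝ, ROeMDP.IsOptimal g' r' γ N π → ∀ ψ : ℝ → Fin K → ℝ,
      (∀ y ∈ Icc (0 : ℝ) N, ψ y ∈ ROeMDP.actions g' r' (π y)) →
      ∀ σ : Fin (N + 1) → (Fin N → Fin K) → ℝ, B.IsOptimal γ σ →
      (∀ k, Plays σ k ∨ PlaysMixed N ψ k → k ∈ S) → ∀ ε : ℝ, 0 ≤ ε →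
      (∀ k ∈ S, |g k - g' k| ≤ ε) → (∀ k ∈ S, |r k - r' k| ≤ ε) →
      |B.optValue γ x - B.value γ (mixedPolicy N ψ) x| ≤
        C * (N * (B.maxGrowth / √((x : ℕ) : ℝ) + ε)) := by
  obtain ⟨ε₀, C, hε₀, hupper, hlower⟩ := exists_comparison hγ0 hγ1 S g r hg
  have h1γ : 0 < 1 - γ := by linarith
  set R := ∑ k, |r k| with hR
  have hR0 : 0 ≤ R := Finset.sum_nonneg fun _ _ => abs_nonneg _
  refine ⟨max (2 * C) 0 + 2 * R / ((1 - γ) * ε₀), by positivity, ?_⟩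
  rintro B rfl rfl N x hx g' r' hg' π hπ ψ hψ σ hσ hS ε hε hgε hrε
  have hN : (0 : ℝ) ≤ N := Nat.cast_nonneg N
  have hmix : IsPolicy (mixedPolicy N ψ) := isPolicy_mixedPolicy fun y hy => (hψ y hy).1
  have hle := B.value_le_optValue hγ0 hγ1 hmix x
  rw [abs_of_nonneg (by linarith)]
  have hX : 0 ≤ (B.maxGrowth : ℝ) / √((x : ℕ) : ℝ) := by positivity
  have hX' : 0 ≤ N * ((B.maxGrowth : ℝ) / √((x : ℕ) : ℝ) + ε) := by positivity
  rw [add_mul]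
  rcases le_or_gt ε₀ ε with hεε₀ | hεε₀
  · -- for a large error, the values are bounded by a multiple of `N`
    have hRk : ∀ k, |B.meanReward k| ≤ R := fun k =>
      Finset.single_le_sum (f := fun k => |B.meanReward k|) (fun _ _ => abs_nonneg _)
        (Finset.mem_univ k)
    have h1 := (abs_le.1 (B.abs_value_le hγ0 hγ1 hσ.1 hRk hR0 x)).2
    have h2 := (abs_le.1 (B.abs_value_le hγ0 hγ1 hmix hRk hR0 x)).1
    rw [hσ.2 x] at h1
    have h3 : 2 * R / ((1 - γ) * ε₀) * (N * ε₀) ≤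
        2 * R / ((1 - γ) * ε₀) * (N * (B.maxGrowth / √((x : ℕ) : ℝ) + ε)) := by
      gcongr
      linarith
    have h4 : 2 * R / ((1 - γ) * ε₀) * (N * ε₀) = 2 * ((1 - γ)⁻¹ * (N * R)) := by
      field_simp
    have h5 := mul_nonneg (le_max_right (2 * C) 0) hX'
    linarith
  · obtain ⟨hV, hVψ⟩ := ROeMDP.isReducedValue_of_isOptimal hγ0 hγ1 hg' hπ hψ (S := S)
      fun y hy k hk => hS k (Or.inr ⟨y, hy, hk⟩)
    set V := ROeMDP.value g' r' γ N π
    obtain ⟨Φ, hΦ, hΦstep⟩ := hupper g' r' ε B.maxGrowth N V hε hεε₀.le (Nat.cast_nonneg _)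
      (fun k _ => hg' k) hgε hrε hV
    obtain ⟨Φ', hΦ', hΦstep'⟩ := hlower g' r' ε B.maxGrowth N V hε hεε₀.le (Nat.cast_nonneg _)
      (fun k _ => hg' k) hgε hrε hV
    have h1 : B.value γ σ x ≤ V (x : ℕ) + Φ (x : ℕ) := by
      refine B.value_le_of_superharmonic hγ0 hγ1 hσ.1 (H := fun z => V (z : ℕ) + Φ (z : ℕ))
        (fun z => ?_) x
      calc _ ≤ ∑ a, σ z a * (V (z : ℕ) + Φ (z : ℕ)) := by
            refine Finset.sum_le_sum fun a _ => ?_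
            rcases ((hσ.1 z).1 a).eq_or_lt with h0 | h0
            · rw [← h0, zero_mul, zero_mul]
            · refine mul_le_mul_of_nonneg_left ?_ h0.le
              rw [stepExpect_eq_sum]
              exact hΦstep z _ _ _
                (B.isStep_action z a fun i => hS _ (Or.inl ⟨z, a, h0, i, rfl⟩))
        _ = V (z : ℕ) + Φ (z : ℕ) := by rw [← Finset.sum_mul, (hσ.1 z).2, one_mul]
    have h2 : V (x : ℕ) - Φ' (x : ℕ) ≤ B.value γ (mixedPolicy N ψ) x := by
      refine B.le_value_of_subharmonic hγ0 hγ1 hmix (H := fun z => V (z : ℕ) - Φ' (z : ℕ))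
        (fun z => ?_) x
      simp only [mul_add, Finset.sum_add_distrib, mul_left_comm _ γ, ← Finset.mul_sum,
        sum_policy_stepExpect]
      have hz := IsStep.cast_mem_Icc z
      have hatt : ((z : ℕ) : ℝ) • ψ (z : ℕ) ∈ allocations S (z : ℕ) ∧ V (z : ℕ) =
          (((z : ℕ) : ℝ) • ψ (z : ℕ)) ⬝ᵥ r' +
            γ * V (min ((((z : ℕ) : ℝ) • ψ (z : ℕ)) ⬝ᵥ g') N) := by
        rcases hz.1.eq_or_lt with h0 | h0
        · rw [← h0, zero_smul, zero_dotProduct, zero_dotProduct, min_eq_left hN,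
            hV.zero hγ1 hN]
          exact ⟨zero_mem_allocations, by simp⟩
        · exact hVψ _ ⟨h0, hz.2⟩
      exact hΦstep' z _ _ _ (B.isStep_mixed z (hψ _ hz).1 hatt.1) hatt.2
    have hxN : (x : ℕ) ≤ N := Nat.lt_succ_iff.mp x.2
    have h3 := hΦ (x : ℕ) hx hxN
    have h4 := hΦ' (x : ℕ) hx hxN
    rw [hσ.2 x] at h1
    have h5 := mul_le_mul_of_nonneg_right (le_max_left (2 * C) 0) hX'
    have h6 : 0 ≤ 2 * R / ((1 - γ) * ε₀) * (N * (B.maxGrowth / √((x : ℕ) : ℝ) + ε)) :=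
      mul_nonneg (by positivity) hX'
    linarith

end CrowdBandit

theorem theorem2 {K : ℕ} (hK : 0 < K) (γ : ℝ) (hγ0 : 0 ≤ γ) (hγ1 : γ < 1)
    -- the true expected growths and expected rewards of the arms
    (g r : Fin K → ℝ) (hr : ¬ IsGreatest (Set.range r) 0) :
    ∃ C : ℝ, 0 < C ∧
      ∀ B : CrowdBandit K, (∀ k, B.meanGrowth k = g k) → (∀ k, B.meanReward k = r k) →
      -- the maximal crowd and the current crowd
      ∀ (N : ℕ) (x : Fin (N + 1)), 2 ≤ (x : ℕ) →
      -- the estimated parameters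
      ∀ g' r' : Fin K → ℝ, (∀ k, 0 ≤ g' k) →
      -- an optimal policy of the estimated ROeMDP, implemented by distributions over the arms
      ∀ π : ℝ → ℝ, ROeMDP.IsOptimal g' r' γ N π →
      ∀ ψ : ℝ → Fin K → ℝ, (∀ y ∈ Set.Icc (0 : ℝ) N, ψ y ∈ ROeMDP.actions g' r' (π y)) →
      -- an optimal policy of the true Populated MDP
      ∀ σ : Fin (N + 1) → (Fin N → Fin K) → ℝ, B.IsOptimal γ σ →
        |B.optValue γ x - B.value γ (CrowdBandit.mixedPolicy N ψ) x| ≤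
          C * ((B.maxGrowth : ℝ) * ROeMDP.maxValue g r γ N / (1 - γ) *
                Real.sqrt (Real.log (x : ℕ) / (x : ℕ)) +
              B.modelError g' r' σ ψ * ROeMDP.maxValue g r γ N / (1 - γ)) := by
  classical
  by_cases hg : ∀ k, 0 ≤ g k
  swap
  · -- expected growths are nonnegative
    exact ⟨1, one_pos, fun B hBg => absurd (fun k => hBg k ▸ B.meanGrowth_nonneg k) hg⟩
  have h1γ : 0 < 1 - γ := by linarith
  have : Nonempty (Fin K) := ⟨⟨0, hK⟩⟩
  obtain ⟨k₀, hk₀⟩ := Finite.exists_max r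
  have hrk₀ : r k₀ ≠ 0 := by
    intro h
    refine hr ⟨⟨k₀, h⟩, ?_⟩
    rintro _ ⟨k, rfl⟩
    exact h ▸ hk₀ k
  have hc : 0 < |r k₀| := abs_pos.2 hrk₀
  have hl : 0 < √(Real.log 2) := Real.sqrt_pos.2 (Real.log_pos one_lt_two)
  have hl1 : √(Real.log 2) ≤ 1 := Real.sqrt_le_one.2 (by linarith [Real.log_two_lt_d9])
  choose C hC0 hC using fun S : Finset (Fin K) =>
    CrowdBandit.exists_abs_optValue_sub_value_le hγ0 hγ1 S g r hg
  have hCsum : 0 ≤ ∑ S, C S := Finset.sum_nonneg fun S _ => hC0 S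
  refine ⟨(∑ S, C S) / (|r k₀| * √(Real.log 2)) + 1, by positivity, ?_⟩
  intro B hBg hBr N x hx g' r' hg' π hπ ψ hψ σ hσ
  set ε := B.modelError g' r' σ ψ with hε_def
  have hbdd : BddAbove {e | ∃ k, (CrowdBandit.Plays σ k ∨ CrowdBandit.PlaysMixed N ψ k) ∧
      e = max |B.meanGrowth k - g' k| |B.meanReward k - r' k|} := by
    refine (Set.finite_range fun k =>
      max |B.meanGrowth k - g' k| |B.meanReward k - r' k|).bddAbove.mono ?_
    rintro _ ⟨k, -, rfl⟩
    exact ⟨k, rfl⟩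
  have hε0 : 0 ≤ ε := Real.sSup_nonneg <| by
    rintro _ ⟨k, -, rfl⟩
    exact le_max_of_le_left (abs_nonneg _)
  set S := Finset.univ.filter fun k => CrowdBandit.Plays σ k ∨ CrowdBandit.PlaysMixed N ψ k
    with hS
  have hclose : ∀ k ∈ S, max |g k - g' k| |r k - r' k| ≤ ε := by
    intro k hk
    rw [← hBg, ← hBr]
    exact le_csSup hbdd ⟨k, (Finset.mem_filter.1 hk).2, rfl⟩
  have hmain := hC S B (funext hBg) (funext hBr) N x (by omega) g' r' hg' π hπ ψ hψ σ hσ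
    (fun k hk => Finset.mem_filter.2 ⟨Finset.mem_univ k, hk⟩) ε hε0
    (fun k hk => (le_max_left _ _).trans (hclose k hk))
    (fun k hk => (le_max_right _ _).trans (hclose k hk))
  refine hmain.trans ?_
  have hCS : C S ≤ ∑ S, C S :=
    Finset.single_le_sum (f := C) (fun S _ => hC0 S) (Finset.mem_univ S)
  have hN : (0 : ℝ) ≤ N := Nat.cast_nonneg N
  have hmax : N * |r k₀| ≤ ROeMDP.maxValue g r γ N := ROeMDP.mul_abs_le_maxValue hγ0 hγ1 hg hk₀
  set W := ROeMDP.maxValue g r γ N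
  have hW0 : 0 ≤ W := (mul_nonneg hN hc.le).trans hmax
  have hWγ : W ≤ W / (1 - γ) := le_div_self hW0 h1γ (by linarith)
  have hx2 : (2 : ℝ) ≤ (x : ℕ) := by exact_mod_cast hx
  have hx0 : (0 : ℝ) < √((x : ℕ) : ℝ) := Real.sqrt_pos.2 (by linarith)
  have hlog : √(Real.log 2) / √((x : ℕ) : ℝ) ≤ √(Real.log (x : ℕ) / (x : ℕ)) := by
    rw [← Real.sqrt_div (Real.log_pos one_lt_two).le]
    refine Real.sqrt_le_sqrt ?_
    gcongr
  have hM : (0 : ℝ) ≤ B.maxGrowth := Nat.cast_nonneg _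
  set q := |r k₀| * √(Real.log 2) with hq
  have hq0 : 0 < q := mul_pos hc hl
  have hA : q * (N * (B.maxGrowth / √((x : ℕ) : ℝ))) ≤
      B.maxGrowth * W / (1 - γ) * √(Real.log (x : ℕ) / (x : ℕ)) := by
    calc q * (N * (B.maxGrowth / √((x : ℕ) : ℝ)))
        = B.maxGrowth * (N * |r k₀|) * (√(Real.log 2) / √((x : ℕ) : ℝ)) := by rw [hq]; ring
      _ ≤ B.maxGrowth * (W / (1 - γ)) * √(Real.log (x : ℕ) / (x : ℕ)) := by
          gcongr
          exact hmax.trans hWγ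
      _ = _ := by ring
  have hB : q * (N * ε) ≤ ε * W / (1 - γ) := by
    calc q * (N * ε) = ε * (N * |r k₀|) * √(Real.log 2) := by rw [hq]; ring
      _ ≤ ε * (W / (1 - γ)) * 1 := by
          gcongr
          exact hmax.trans hWγ
      _ = _ := by ring
  set A := (B.maxGrowth : ℝ) * W / (1 - γ) * √(Real.log (x : ℕ) / (x : ℕ))
  have hA0 : 0 ≤ A := by positivity
  have hB0 : 0 ≤ ε * W / (1 - γ) := by positivity
  calc C S * (N * (B.maxGrowth / √((x : ℕ) : ℝ) + ε))
      ≤ (∑ S, C S) * (N * (B.maxGrowth / √((x : ℕ) : ℝ) + ε)) := by gcongr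
    _ = (∑ S, C S) / q *
        (q * (N * (B.maxGrowth / √((x : ℕ) : ℝ))) + q * (N * ε)) := by
        field_simp
    _ ≤ (∑ S, C S) / q * (A + ε * W / (1 - γ)) := by gcongr
    _ ≤ _ := by
        rw [add_mul, one_mul]
        linarith
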